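/- There is an absolute constant $C>0$ such that the following holds. Let $\mathcal X\subseteq\mathbb R^d$ be a closed convex set and let $f,r:\mathbb R^d\to\mathbb R$ be convex. Put $F=f+r$, and assume that $x_\star\in\mathcal X$ satisfies $F_\star:=F(x_\star)=\inf_{x\in\mathcal X}F(x)$. Assume that $r$ is $\mu$-strongly convex on $\mathcal X$ for some $\mu>0$, i.e. $r(x)\ge r(y)+\langle\nabla r(y),x-y\rangle+\frac{\mu}{2}\|x-y\|^2$ for all $x,y\in\mathcal X$, with $\nabla r(y)\in\partial r(y)$. Let $\nabla f(x)\in\partial f(x)$, $x\in\mathcal X$, be subgradients with $\|\nabla f(x)\|\le G$ for all $x\in\mathcal X$, where $G\ge 0$. Let $p\in(1,2]$, let $\mathcal D$ be a probability distribution on a space $\Xi$ and let $g:\mathcal X\times\Xi\to\mathbb R^d$ be measurable, such that for all $x\in\mathcal X$ and all unit vectors $e\in\mathbb R^d$ $$\mathbb E_{\xi\sim\mathcal D}[g(x,\xi)]=\nabla f(x),\qquad \mathbb E\big[|\langle e,g(x,\xi)-\nabla f(x)\rangle|^p\big]\le\sigma_s^p,\qquad \mathbb E\big[\|g(x,\xi)-\nabla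 f(x)\|^p\big]\le\sigma_l^p,$$ where $0\le\sigma_s\le\sigma_l\le\sqrt{\pi d/2}\,\sigma_s$. Let $\delta\in(0,1]$, put $d_{\mathrm{eff}}=\sigma_l^2/\sigma_s^2$ (with $0/0=0$) and $$\tau_\star=\Big(\min\Big\{\frac{\sigma_s\sigma_l^{p-1}}{\ln\frac3\delta},\ \frac{\sigma_s^2}{\sigma_l^{2-p}\mathbf 1[p<2]}\Big\}\Big)^{1/p},\qquad \varphi_\star=\max\Big\{\sqrt{d_{\mathrm{eff}}}\,\ln\tfrac3\delta,\ d_{\mathrm{eff}}\mathbf 1[p<2]\Big\},$$ where the second entry of the minimum is omitted if $p=2$, and $0/0=0$ if $\sigma_l=0$. Let $T\ge1$ be an integer. Run Clipped SGD from a point $x_1\in\mathcal X$ for $t=1,\dots,T$: $$g_t^c=\min\Big\{1,\frac{\tau_t}{\|g(x_t,\xi_t)\|}\Big\}\,g(x_t,\xi_t),\qquad x_{t+1}=\operatorname*{argmin}_{x\in\mathcal X}\Big\{r(x)+\langle g_t^c,x\rangle+\frac{\|x-x_t\|^2}{2\eta_t}\Big\},$$ with $\xi_1,\dots,\xi_T$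 independent of law $\mathcal D$ and with the parameters (which do not depend on $T$) $$\eta_t=\frac{6}{\mu t},\qquad \tau_t=\max\{2G,\ \tau_\star t^{1/p}\}.$$ Let $D=\|x_\star-x_1\|$, $\bar x=\frac{\sum_{t=1}^T(t+4)(t+5)x_{t+1}}{\sum_{t=1}^T(t+4)(t+5)}$ and $$\varphi=\min\Big\{\varphi_\star,\ \sqrt{2^{-p}\varphi_\star(\sigma_l/G)^pT}\Big\}\qquad(\varphi=\varphi_\star\text{ if }G=0).$$ Then $\varphi\le\varphi_\star$, with equality whenever $T\ge 2^p\frac{G^p}{\sigma_l^p}\varphi_\star$, and with probability at least $1-\delta$ both $F(\bar x)-F_\star$ and $\mu\|x_{T+1}-x_\star\|^2$ are at most $$C\left(\frac{\mu D^2}{T^3}+\frac{(\varphi^2+\ln^2\frac3\delta)G^2}{\mu T^2}+\frac{(\sigma_l^p+\sigma_s^p\ln\frac3\delta)G^{2-p}+G^2}{\mu T}+\frac{\sigma_s^{\frac4p-2}\sigma_l^{4-\frac4p}+\sigma_s^{\frac2p}\sigma_l^{2-\frac2p}\ln^{2-\frac2p}\frac3\delta}{\mu T^{2-\frac2p}}\right),$$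 where $0^0=1$. -/

import Mathlib

open MeasureTheory ProbabilityTheory
open scoped RealInnerProductSpace

namespace ClippedSGD

noncomputable section

/-- The subdifferential `∂h(x)` of a function `h : ℝᵈ → ℝ` at `x`. -/
def subdifferential {d : ℕ} (h : EuclideanSpace ℝ (Fin d) → ℝ)
    (x : EuclideanSpace ℝ (Fin d)) : Set (EuclideanSpace ℝ (Fin d)) :=
  {v | ∀ y, h x + ⟪v, y - x⟫ ≤ h y}

/-- `h(x) ≥ h(y) + ⟨∇h(y), x - y⟩ + (μ/2)‖x - y‖²` for all `x, y ∈ X`, where `∇h(y) ∈ ∂h(y)`.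
For a convex `h : ℝᵈ → ℝ` it is the same to ask for one subgradient at each `y` or for all of
them; the formally weaker form is used, because it serves as a hypothesis. -/
def StronglyConvexFirstOrder {d : ℕ} (X : Set (EuclideanSpace ℝ (Fin d))) (μ : ℝ)
    (h : EuclideanSpace ℝ (Fin d) → ℝ) : Prop :=
  ∀ y ∈ X, ∃ v ∈ subdifferential h y,
    ∀ x ∈ X, h y + ⟪v, x - y⟫ + μ / 2 * ‖x - y‖ ^ 2 ≤ h x

/-- `g : X × Ξ → ℝᵈ` is, for samples of law `𝒟`, an unbiased estimator of `gradf` on `X` with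
`p`-th noise moments bounded by `σs ^ p` in every direction and by `σl ^ p` in norm.  The moments
are `[0, ∞]`-valued integrals, so that the bounds include finiteness. -/
structure HeavyTailedOracle {d : ℕ} {Ξ : Type*} [MeasurableSpace Ξ]
    (X : Set (EuclideanSpace ℝ (Fin d)))
    (gradf : EuclideanSpace ℝ (Fin d) → EuclideanSpace ℝ (Fin d))
    (g : EuclideanSpace ℝ (Fin d) → Ξ → EuclideanSpace ℝ (Fin d))
    (𝒟 : Measure Ξ) (p σs σl : ℝ) : Prop where
  measurable : Measurable fun q : X × Ξ => g (q.1 : EuclideanSpace ℝ (Fin d)) q.2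
  integrable : ∀ x ∈ X, Integrable (g x) 𝒟
  unbiased : ∀ x ∈ X, ∫ z, g x z ∂𝒟 = gradf x
  directional_moment : ∀ x ∈ X, ∀ e : EuclideanSpace ℝ (Fin d), ‖e‖ = 1 →
    ∫⁻ z, ENNReal.ofReal (|⟪e, g x z - gradf x⟫| ^ p) ∂𝒟 ≤ ENNReal.ofReal (σs ^ p)
  norm_moment : ∀ x ∈ X,
    ∫⁻ z, ENNReal.ofReal (‖g x z - gradf x‖ ^ p) ∂𝒟 ≤ ENNReal.ofReal (σl ^ p)
  zero_le_small : 0 ≤ σs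
  small_le_large : σs ≤ σl
  large_le : σl ≤ √(Real.pi * d / 2) * σs

/-- `clip_τ(v) = min{1, τ/‖v‖} v`. -/
def clip {d : ℕ} (τ : ℝ) (v : EuclideanSpace ℝ (Fin d)) : EuclideanSpace ℝ (Fin d) :=
  min 1 (τ / ‖v‖) • v

/-- `u` is a minimizer over `X` of `r(u) + ⟨v, u⟩ + ‖u - y‖² / (2η)`. -/
def IsProxStep {d : ℕ} (X : Set (EuclideanSpace ℝ (Fin d)))
    (r : EuclideanSpace ℝ (Fin d) → ℝ) (η : ℝ) (v y u : EuclideanSpace ℝ (Fin d)) : Prop :=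
  u ∈ X ∧ IsMinOn (fun w => r w + ⟪v, w⟫ + ‖w - y‖ ^ 2 / (2 * η)) X u

/-- `x 1, …, x (T + 1)` are the iterates of `T` steps of proximal Clipped SGD started at `x₁`, with
stepsizes `η t`, clipping thresholds `τ t` and samples `ξ t`, for `t = 1, …, T`. -/
def IsClippedSGDRun {d : ℕ} {Ξ Ω : Type*} (X : Set (EuclideanSpace ℝ (Fin d)))
    (r : EuclideanSpace ℝ (Fin d) → ℝ)
    (g : EuclideanSpace ℝ (Fin d) → Ξ → EuclideanSpace ℝ (Fin d))
    (η τ : ℕ → ℝ) (x₁ : EuclideanSpace ℝ (Fin d)) (ξ : ℕ → Ω → Ξ) (T : ℕ)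
    (x : ℕ → Ω → EuclideanSpace ℝ (Fin d)) : Prop :=
  ∀ ω, x 1 ω = x₁ ∧
    ∀ t, 1 ≤ t → t ≤ T →
      IsProxStep X r (η t) (clip (τ t) (g (x t ω) (ξ t ω))) (x t ω) (x (t + 1) ω)

/-- `x₂, …, x_{T+1}` averaged with weights `(t + 4)(t + 5)`, `t = 1, …, T`. -/
def weightedAverage {d : ℕ} (T : ℕ) (x : ℕ → EuclideanSpace ℝ (Fin d)) :
    EuclideanSpace ℝ (Fin d) :=
  (∑ t ∈ Finset.Icc 1 T, ((t : ℝ) + 4) * ((t : ℝ) + 5))⁻¹ •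
    ∑ t ∈ Finset.Icc 1 T, (((t : ℝ) + 4) * ((t : ℝ) + 5)) • x (t + 1)

/-- `τ⋆ = (min{σs σl^(p-1) / ln(3/δ), σs² / (σl^(2-p) 1[p<2])})^(1/p)`; for `p = 2` the second
entry has a zero denominator and is read as absent (`+∞`). -/
def tauStar (p σs σl δ : ℝ) : ℝ :=
  (if p < 2 then
      min (σs * σl ^ (p - 1) / Real.log (3 / δ)) (σs ^ 2 / σl ^ (2 - p))
    else σs * σl ^ (p - 1) / Real.log (3 / δ)) ^ (1 / p)

/-- The generalized effective dimension `σl² / σs²`, with `0 / 0 = 0`. -/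
def dEff (σs σl : ℝ) : ℝ := σl ^ 2 / σs ^ 2

/-- `φ⋆ = max{√d_eff ln(3/δ), d_eff 1[p<2]}`. -/
def phiStar (p σs σl δ : ℝ) : ℝ :=
  max (√(dEff σs σl) * Real.log (3 / δ)) (if p < 2 then dEff σs σl else 0)

/-- `φ = min{φ⋆, √((1/2)^p φ⋆ (σl/G)^p T)}`; for `G = 0` the second entry is read as absent. -/
def phi (p σs σl δ G : ℝ) (T : ℕ) : ℝ :=
  if G = 0 then phiStar p σs σl δ
  else min (phiStar p σs σl δ)
    √((1 / 2) ^ p * phiStar p σs σl δ * (σl / G) ^ p * T)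

/-- The rate, without the absolute constant. -/
def rate (p σs σl δ G μ D : ℝ) (T : ℕ) : ℝ :=
  μ * D ^ 2 / (T : ℝ) ^ 3
    + (phi p σs σl δ G T ^ 2 + Real.log (3 / δ) ^ 2) * G ^ 2 / (μ * (T : ℝ) ^ 2)
    + ((σl ^ p + σs ^ p * Real.log (3 / δ)) * G ^ (2 - p) + G ^ 2) / (μ * T)
    + (σs ^ (4 / p - 2) * σl ^ (4 - 4 / p)
        + σs ^ (2 / p) * σl ^ (2 - 2 / p) * Real.log (3 / δ) ^ (2 - 2 / p))
      / (μ * (T : ℝ) ^ (2 - 2 / p))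

end

end ClippedSGD

/-! Write a_t = ‖x_t − x⋆‖² and split the clipped gradient into ∇f(x_t), a bias and a centred noise
u_t. The three-point inequality of the proximal step bounds F(x_{t+1}) − F⋆ by −⟨u_t, x_t − x⋆⟩, the
squared bias, η_t(G² + ‖u_t‖²) and a difference of multiples of a_t and a_{t+1}
(`IsProxStep.descent`). For η_t = 6/(μt), the weights (t+4)(t+5) make this difference telescope and
leave a surplus (μ/4)(t+4)(t+5)a_t on the left (`weighted_telescope`).

Since τ_t ≥ 2G, a sample is clipped only if its noise is at least τ_t/2. Hence the p-th moments
control the bias, the variance and the directional variance of the clipped gradient. The choice of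
τ⋆ makes each of these at most a term of the rate (`Admissible.bias_bound`,
`Admissible.variance_bound`, `Admissible.directional_bound`).

The sum of η_t‖u_t‖² has nonnegative bounded terms and needs only a one-sided Chernoff bound. The
linear term is a martingale whose increments grow with √a_t, for which no a priori bound exists. It
is therefore multiplied by the indicator that μs³a_s ≤ 12B for all s ≤ t, where B is a large
multiple of T³ times the rate. The increments are then bounded by B/(2 ln(3/δ)), and their
conditional variance is proportional to a_t, so that Bernstein's compensator is absorbed by the
surplus (`measure_sum_sub_gt_le`). On the good event the recursion, stopped just before a first
violation of μs³a_s ≤ 12B, would refute that violation (`bootstrap`). So the indicator is always 1,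
and the weighted sum of the gaps and the last distance are bounded together. -/

open scoped ENNReal

namespace ClippedSGD

/-! ### Bias and variance of a clipped heavy-tailed vector. -/

section Clip

variable {d : ℕ}

lemma clip_of_norm_le {τ : ℝ} {v : EuclideanSpace ℝ (Fin d)} (h : ‖v‖ ≤ τ) : clip τ v = v := by
  rcases eq_or_ne v 0 with rfl | hv
  · simp [clip]
  · have : 1 ≤ τ / ‖v‖ := (one_le_div (norm_pos_iff.2 hv)).2 h
    simp [clip, min_eq_left this]

lemma clip_of_lt_norm {τ : ℝ} {v : EuclideanSpace ℝ (Fin d)} (hτ : 0 ≤ τ) (h : τ < ‖v‖) :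
    clip τ v = (τ / ‖v‖) • v := by
  have : τ / ‖v‖ ≤ 1 := (div_le_one (hτ.trans_lt h)).2 h.le
  simp [clip, min_eq_right this]

lemma norm_clip_le {τ : ℝ} (hτ : 0 ≤ τ) (v : EuclideanSpace ℝ (Fin d)) : ‖clip τ v‖ ≤ τ := by
  rcases le_or_gt ‖v‖ τ with h | h
  · rwa [clip_of_norm_le h]
  · have hv : 0 < ‖v‖ := hτ.trans_lt h
    rw [clip_of_lt_norm hτ h, norm_smul, Real.norm_of_nonneg (by positivity)]
    field_simp
    exact le_rfl

lemma measurable_clip (τ : ℝ) : Measurable (clip τ : EuclideanSpace ℝ (Fin d) → _) := by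
  unfold clip
  fun_prop

/-- Of the two factors of the square, the power 2 − p is estimated by the truncation level b and the
power p by the untruncated y. This is how a finite p-th moment gives a second moment after clipping.
-/
lemma sq_le_rpow_mul_rpow {p y c b : ℝ} (hp : 1 < p) (hp2 : p ≤ 2) (hy : 0 ≤ y) (hc : 0 ≤ c)
    (hc1 : c ≤ 1) (hb : c * y ≤ b) : (c * y) ^ 2 ≤ b ^ (2 - p) * y ^ p := by
  have h0 : 0 ≤ c * y := mul_nonneg hc hy
  calc (c * y) ^ 2 = (c * y) ^ (2 - p) * (c * y) ^ p := by
        rw [← Real.rpow_add_of_nonneg h0 (by linarith) (by linarith)]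
        norm_num
    _ ≤ b ^ (2 - p) * y ^ p := by
        have h1 : c * y ≤ y := mul_le_of_le_one_left hy hc1
        gcongr
        exact Real.rpow_nonneg (h0.trans hb) _

/-- Clipping happens only where the noise is at least half of the threshold. -/
lemma one_le_rpow_of_lt_norm {p τ G : ℝ} {v m : EuclideanSpace ℝ (Fin d)} (hp : 1 < p)
    (hτ : 0 < τ) (hm : ‖m‖ ≤ G) (hG : 2 * G ≤ τ) (h : τ < ‖v‖) :
    1 ≤ (2 / τ) ^ p * ‖v - m‖ ^ p := by
  have h1 : ‖v‖ ≤ ‖v - m‖ + ‖m‖ := by simpa using norm_add_le (v - m) m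
  rw [← Real.mul_rpow (by positivity) (by positivity)]
  refine Real.one_le_rpow ?_ (by linarith)
  rw [div_mul_eq_mul_div, one_le_div hτ]
  linarith

/-- The error of the clipped vector is a contracted copy of the noise plus a part of the mean that
vanishes unless clipping happens. -/
lemma clip_sub_eq {p τ G : ℝ} {v m : EuclideanSpace ℝ (Fin d)} (hp : 1 < p)
    (hτ : 0 < τ) (hm : ‖m‖ ≤ G) (hG : 2 * G ≤ τ) :
    ∃ c b : ℝ, 0 ≤ c ∧ c ≤ 1 ∧ c * ‖v - m‖ ≤ 2 * τ ∧ 0 ≤ b ∧ b ≤ 1 ∧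
      b ≤ (2 / τ) ^ p * ‖v - m‖ ^ p ∧ clip τ v - m = c • (v - m) - b • m ∧
      clip τ v - v = - (b • (v - m)) - b • m := by
  have hG0 : 0 ≤ G := (norm_nonneg m).trans hm
  have h1 : ‖v - m‖ ≤ ‖v‖ + ‖m‖ := norm_sub_le v m
  rcases le_or_gt ‖v‖ τ with h | h
  · refine ⟨1, 0, zero_le_one, le_rfl, by linarith, le_rfl, zero_le_one, by positivity, ?_, ?_⟩ <;>
      simp [clip_of_norm_le h]
  · have hv : 0 < ‖v‖ := hτ.trans h
    have hc : τ / ‖v‖ ≤ 1 := (div_le_one hv).2 h.le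
    have hc0 : 0 ≤ τ / ‖v‖ := by positivity
    refine ⟨τ / ‖v‖, 1 - τ / ‖v‖, hc0, hc, ?_, by linarith, by linarith,
      (by linarith : 1 - τ / ‖v‖ ≤ 1).trans (one_le_rpow_of_lt_norm hp hτ hm hG h), ?_, ?_⟩
    · have : τ / ‖v‖ * ‖v‖ = τ := by field_simp
      nlinarith [mul_le_mul_of_nonneg_left h1 hc0, norm_nonneg m]
    · rw [clip_of_lt_norm hτ.le h]; module
    · rw [clip_of_lt_norm hτ.le h]; module

/-- In the decomposition of `clip_sub_eq`, the contracted noise is treated by `sq_le_rpow_mul_rpow`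
in the direction e alone, so that σs and not σl appears with it. For the part along the mean, b² ≤ b
is at most the Markov factor. -/
lemma inner_clip_sub_sq_le {p τ G : ℝ} {v m e : EuclideanSpace ℝ (Fin d)} (hp : 1 < p)
    (hp2 : p ≤ 2) (hτ : 0 < τ) (hm : ‖m‖ ≤ G) (hG : 2 * G ≤ τ) (he : ‖e‖ = 1) :
    ⟪e, clip τ v - m⟫ ^ 2 ≤
      2 * (2 * τ) ^ (2 - p) * |⟪e, v - m⟫| ^ p + 2 * G ^ 2 * ((2 / τ) ^ p * ‖v - m‖ ^ p) := by
  obtain ⟨c, b, hc0, hc1, hcτ, hb0, hb1, hb, h, -⟩ := clip_sub_eq (v := v) hp hτ hm hG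
  have hy : |⟪e, v - m⟫| ≤ ‖v - m‖ := by simpa [he] using abs_real_inner_le_norm e (v - m)
  have hM : |⟪e, m⟫| ≤ G := (by simpa [he] using abs_real_inner_le_norm e m : _ ≤ ‖m‖).trans hm
  have h1 := sq_le_rpow_mul_rpow hp hp2 (abs_nonneg ⟪e, v - m⟫) hc0 hc1
    ((mul_le_mul_of_nonneg_left hy hc0).trans hcτ)
  have h2 : (b * ⟪e, m⟫) ^ 2 ≤ G ^ 2 * ((2 / τ) ^ p * ‖v - m‖ ^ p) := by
    have h3 : ⟪e, m⟫ ^ 2 ≤ G ^ 2 := sq_le_sq' (by linarith [neg_abs_le ⟪e, m⟫])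
      ((le_abs_self _).trans hM)
    calc (b * ⟪e, m⟫) ^ 2 = ⟪e, m⟫ ^ 2 * (b * b) := by ring
      _ ≤ G ^ 2 * (1 * ((2 / τ) ^ p * ‖v - m‖ ^ p)) := by gcongr
      _ = _ := by ring
  have h4 : (c * |⟪e, v - m⟫|) ^ 2 = (c * ⟪e, v - m⟫) ^ 2 := by
    rw [mul_pow, sq_abs, mul_pow]
  rw [h, inner_sub_right, inner_smul_right, inner_smul_right]
  nlinarith [sq_nonneg (c * ⟪e, v - m⟫ + b * ⟪e, m⟫)]

lemma norm_clip_sub_sq_le {p τ G : ℝ} {v m : EuclideanSpace ℝ (Fin d)} (hp : 1 < p)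
    (hp2 : p ≤ 2) (hτ : 0 < τ) (hm : ‖m‖ ≤ G) (hG : 2 * G ≤ τ) :
    ‖clip τ v - m‖ ^ 2 ≤
      (2 * (2 * τ) ^ (2 - p) + 2 * G ^ 2 * (2 / τ) ^ p) * ‖v - m‖ ^ p := by
  obtain ⟨c, b, hc0, hc1, hcτ, hb0, hb1, hb, h, -⟩ := clip_sub_eq (v := v) hp hτ hm hG
  have h1 := sq_le_rpow_mul_rpow hp hp2 (norm_nonneg (v - m)) hc0 hc1 hcτ
  have h2 : (b * ‖m‖) ^ 2 ≤ G ^ 2 * ((2 / τ) ^ p * ‖v - m‖ ^ p) := by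
    calc (b * ‖m‖) ^ 2 = ‖m‖ ^ 2 * (b * b) := by ring
      _ ≤ G ^ 2 * (1 * ((2 / τ) ^ p * ‖v - m‖ ^ p)) := by gcongr
      _ = _ := by ring
  have h3 : ‖clip τ v - m‖ ≤ c * ‖v - m‖ + b * ‖m‖ := by
    rw [h]
    refine (norm_sub_le _ _).trans_eq ?_
    rw [norm_smul, norm_smul, Real.norm_of_nonneg hc0, Real.norm_of_nonneg hb0]
  have h4 : ‖clip τ v - m‖ ^ 2 ≤ (c * ‖v - m‖ + b * ‖m‖) ^ 2 := by gcongr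
  nlinarith [sq_nonneg (c * ‖v - m‖ - b * ‖m‖)]

/-- The level κ stays free; the bias estimate chooses it to balance the directional moment against
the probability of clipping. -/
lemma le_rpow_mul_rpow_add {p y κ : ℝ} (hp : 1 < p) (hy : 0 ≤ y) (hκ : 0 < κ) :
    y ≤ κ ^ (1 - p) * y ^ p + κ := by
  rcases le_or_gt y κ with h | h
  · have : 0 ≤ κ ^ (1 - p) * y ^ p := by positivity
    linarith
  · have hy0 : 0 < y := hκ.trans h
    have h1 : y = y ^ (1 - p) * y ^ p := by rw [← Real.rpow_add hy0]; simp
    have h2 : y ^ (1 - p) ≤ κ ^ (1 - p) :=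
      Real.rpow_le_rpow_of_nonpos hκ h.le (by linarith)
    have h3 : y ^ (1 - p) * y ^ p ≤ κ ^ (1 - p) * y ^ p := by gcongr
    linarith

lemma abs_inner_clip_sub_self_le {p τ G κ : ℝ} {v m e : EuclideanSpace ℝ (Fin d)} (hp : 1 < p)
    (hτ : 0 < τ) (hm : ‖m‖ ≤ G) (hG : 2 * G ≤ τ) (he : ‖e‖ = 1) (hκ : 0 < κ) :
    |⟪e, clip τ v - v⟫| ≤
      κ ^ (1 - p) * |⟪e, v - m⟫| ^ p + (κ + G) * (2 / τ) ^ p * ‖v - m‖ ^ p := by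
  obtain ⟨c, b, hc0, hc1, hcτ, hb0, hb1, hb, -, h⟩ := clip_sub_eq (v := v) hp hτ hm hG
  have hG0 : 0 ≤ G := (norm_nonneg m).trans hm
  have hM : |⟪e, m⟫| ≤ G := (by simpa [he] using abs_real_inner_le_norm e m : _ ≤ ‖m‖).trans hm
  have h1 := le_rpow_mul_rpow_add hp (abs_nonneg ⟪e, v - m⟫) hκ
  rw [h, inner_sub_right, inner_neg_right, inner_smul_right, inner_smul_right]
  have h2 : |-(b * ⟪e, v - m⟫) - b * ⟪e, m⟫| ≤ b * |⟪e, v - m⟫| + b * |⟪e, m⟫| := by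
    refine (abs_sub _ _).trans_eq ?_
    rw [abs_neg, abs_mul, abs_mul, abs_of_nonneg hb0]
  have h3 : b * |⟪e, v - m⟫| ≤ κ ^ (1 - p) * |⟪e, v - m⟫| ^ p + b * κ := by
    have h5 := mul_le_mul_of_nonneg_left h1 hb0
    have : 0 ≤ κ ^ (1 - p) * |⟪e, v - m⟫| ^ p := by positivity
    nlinarith
  have h4 : b * |⟪e, m⟫| ≤ b * G := by gcongr
  have h5 : b * (κ + G) ≤ (2 / τ) ^ p * ‖v - m‖ ^ p * (κ + G) := by gcongr
  linarith

/-- The mean minimizes the mean squared distance, so a variance may be estimated by centring at the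
unclipped mean instead of the clipped one. -/
lemma integral_norm_sub_integral_sq_le {α H : Type*} [MeasurableSpace α] {ν : Measure α}
    [IsProbabilityMeasure ν] [NormedAddCommGroup H] [InnerProductSpace ℝ H] [CompleteSpace H]
    {Y : α → H} (hY : Integrable Y ν) (c : H) (h2 : Integrable (fun z => ‖Y z - c‖ ^ 2) ν) :
    ∫ z, ‖Y z - ∫ z, Y z ∂ν‖ ^ 2 ∂ν ≤ ∫ z, ‖Y z - c‖ ^ 2 ∂ν := by
  set e := ∫ z, Y z ∂ν with he
  have h : ∀ z, ‖Y z - e‖ ^ 2 = ‖Y z - c‖ ^ 2 - (2 * ⟪e - c, Y z - c⟫ - ‖e - c‖ ^ 2) := by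
    intro z
    have : Y z - e = (Y z - c) - (e - c) := by abel
    rw [this, norm_sub_sq_real, real_inner_comm]
    ring
  have hi : Integrable (fun z => Y z - c) ν := hY.sub (integrable_const c)
  have hi2 : Integrable (fun z => 2 * ⟪e - c, Y z - c⟫) ν := (hi.const_inner (e - c)).const_mul 2
  simp_rw [h]
  rw [integral_sub h2 (hi2.sub' (integrable_const _)), integral_sub hi2 (integrable_const _),
    integral_const_mul, integral_inner hi, integral_sub hY (integrable_const c), ← he]
  simp only [integral_const, probReal_univ, one_smul, real_inner_self_eq_norm_sq]
  nlinarith [sq_nonneg ‖e - c‖]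

/-- `h` has mean `m` and `p`-th noise moments at most `σs ^ p` in each direction and `σl ^ p` in
norm. -/
structure MomentBounds {Ξ : Type*} [MeasurableSpace Ξ] (ν : Measure Ξ)
    (h : Ξ → EuclideanSpace ℝ (Fin d)) (m : EuclideanSpace ℝ (Fin d)) (p σs σl : ℝ) : Prop where
  integrable : Integrable h ν
  mean : ∫ z, h z ∂ν = m
  integrable_inner : ∀ e : EuclideanSpace ℝ (Fin d), ‖e‖ = 1 →
    Integrable (fun z => |⟪e, h z - m⟫| ^ p) ν
  inner_le : ∀ e : EuclideanSpace ℝ (Fin d), ‖e‖ = 1 →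
    ∫ z, |⟪e, h z - m⟫| ^ p ∂ν ≤ σs ^ p
  integrable_norm : Integrable (fun z => ‖h z - m‖ ^ p) ν
  norm_le : ∫ z, ‖h z - m‖ ^ p ∂ν ≤ σl ^ p

section Moments

variable {Ξ : Type*} [MeasurableSpace Ξ] {ν : Measure Ξ} [IsProbabilityMeasure ν]
  {h : Ξ → EuclideanSpace ℝ (Fin d)} {m : EuclideanSpace ℝ (Fin d)} {p σs σl τ G : ℝ}

lemma integrable_clip (hτ : 0 ≤ τ) (hh : AEStronglyMeasurable h ν) :
    Integrable (fun z => clip τ (h z)) ν :=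
  Integrable.of_bound ((measurable_clip τ).comp_aemeasurable hh.aemeasurable).aestronglyMeasurable
    τ (ae_of_all _ fun _ => norm_clip_le hτ _)

lemma norm_integral_clip_le (hτ : 0 ≤ τ) : ‖∫ z, clip τ (h z) ∂ν‖ ≤ τ := by
  simpa using norm_integral_le_of_norm_le_const (μ := ν) (ae_of_all _ fun _ => norm_clip_le hτ _)

lemma norm_clip_sub_integral_le (hτ : 0 ≤ τ) (v : EuclideanSpace ℝ (Fin d)) :
    ‖clip τ v - ∫ z, clip τ (h z) ∂ν‖ ≤ 2 * τ :=
  (norm_sub_le _ _).trans (by linarith [norm_clip_le hτ v, norm_integral_clip_le (ν := ν) (h := h) hτ])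

lemma clip_zero (v : EuclideanSpace ℝ (Fin d)) : clip 0 v = 0 := by
  rw [← norm_le_zero_iff]; exact norm_clip_le le_rfl v

lemma integrable_norm_clip_sub_sq (hτ : 0 ≤ τ) (hh : AEStronglyMeasurable h ν)
    (c : EuclideanSpace ℝ (Fin d)) : Integrable (fun z => ‖clip τ (h z) - c‖ ^ 2) ν := by
  refine Integrable.of_bound (C := (τ + ‖c‖) ^ 2) ?_ (ae_of_all _ fun z => ?_)
  · exact ((integrable_clip hτ hh).1.sub aestronglyMeasurable_const).norm.pow 2
  · rw [Real.norm_of_nonneg (by positivity)]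
    gcongr
    exact (norm_sub_le _ _).trans (by linarith [norm_clip_le hτ (h z)])

lemma two_mul_rpow_le (hp : 1 < p) (hτ : 0 ≤ τ) :
    (2 * τ) ^ (2 - p) ≤ 2 * τ ^ (2 - p) := by
  rw [Real.mul_rpow zero_le_two hτ]
  gcongr
  calc (2 : ℝ) ^ (2 - p) ≤ 2 ^ (1 : ℝ) := by gcongr <;> linarith
    _ = 2 := Real.rpow_one 2

lemma two_div_rpow_le (hp2 : p ≤ 2) (hτ : 0 ≤ τ) :
    (2 / τ) ^ p ≤ 4 * τ ^ (-p) := by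
  rw [Real.div_rpow zero_le_two hτ, Real.rpow_neg hτ, div_eq_mul_inv]
  gcongr
  calc (2 : ℝ) ^ p ≤ 2 ^ (2 : ℝ) := by gcongr; linarith
    _ = 4 := by norm_num

/-- The variance of a clipped vector. -/
lemma MomentBounds.integral_norm_clip_sub_sq_le (H : MomentBounds ν h m p σs σl) (hp : 1 < p)
    (hp2 : p ≤ 2) (hσl : 0 ≤ σl) (hm : ‖m‖ ≤ G) (hG : 2 * G ≤ τ) :
    ∫ z, ‖clip τ (h z) - ∫ z, clip τ (h z) ∂ν‖ ^ 2 ∂ν ≤ 6 * τ ^ (2 - p) * σl ^ p := by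
  have hG0 : 0 ≤ G := (norm_nonneg m).trans hm
  have hτ0 : 0 ≤ τ := by linarith
  rcases hτ0.eq_or_lt with rfl | hτ
  · simp only [clip_zero, integral_zero, sub_zero, norm_zero]
    norm_num
    positivity
  have hi := integrable_norm_clip_sub_sq hτ0 H.integrable.1 m
  refine (integral_norm_sub_integral_sq_le (integrable_clip hτ0 H.integrable.1) m hi).trans ?_
  -- The first summand gives 4 τ^(2−p); since G ≤ τ/2, the second gives at most 2 τ^(2−p).
  have hc : 2 * (2 * τ) ^ (2 - p) + 2 * G ^ 2 * (2 / τ) ^ p ≤ 6 * τ ^ (2 - p) := by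
    have h1 := two_mul_rpow_le hp hτ0
    have h2 := two_div_rpow_le hp2 hτ0
    have h3 : τ ^ (2 - p) = τ ^ 2 * τ ^ (-p) := by
      rw [← Real.rpow_natCast τ 2, ← Real.rpow_add hτ]; norm_num [sub_eq_add_neg]
    have h4 : G ^ 2 ≤ τ ^ 2 / 4 := by nlinarith
    have h5 : G ^ 2 * (2 / τ) ^ p ≤ τ ^ 2 / 4 * (4 * τ ^ (-p)) := by gcongr
    linarith
  calc ∫ z, ‖clip τ (h z) - m‖ ^ 2 ∂ν
      ≤ ∫ z, (2 * (2 * τ) ^ (2 - p) + 2 * G ^ 2 * (2 / τ) ^ p) * ‖h z - m‖ ^ p ∂ν :=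
        integral_mono hi (H.integrable_norm.const_mul _)
          fun z => norm_clip_sub_sq_le hp hp2 hτ hm hG
    _ = (2 * (2 * τ) ^ (2 - p) + 2 * G ^ 2 * (2 / τ) ^ p) * ∫ z, ‖h z - m‖ ^ p ∂ν :=
        integral_const_mul _ _
    _ ≤ 6 * τ ^ (2 - p) * σl ^ p := by
        refine mul_le_mul hc H.norm_le (integral_nonneg fun z => ?_) (by positivity)
        exact Real.rpow_nonneg (norm_nonneg _) _

/-- The variance of a clipped vector along a direction. -/
lemma MomentBounds.integral_inner_clip_sub_sq_le (H : MomentBounds ν h m p σs σl) (hp : 1 < p)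
    (hp2 : p ≤ 2) (hσs : 0 ≤ σs) (hσl : 0 ≤ σl) (hm : ‖m‖ ≤ G) (hG : 2 * G ≤ τ)
    (u : EuclideanSpace ℝ (Fin d)) :
    ∫ z, ⟪u, clip τ (h z) - ∫ z, clip τ (h z) ∂ν⟫ ^ 2 ∂ν ≤
      ‖u‖ ^ 2 * (4 * τ ^ (2 - p) * σs ^ p + 8 * G ^ 2 * τ ^ (-p) * σl ^ p) := by
  have hG0 : 0 ≤ G := (norm_nonneg m).trans hm
  have hτ0 : 0 ≤ τ := by linarith
  rcases hτ0.eq_or_lt with rfl | hτ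
  · simp only [clip_zero, integral_zero, sub_zero, inner_zero_right]
    norm_num
    positivity
  rcases eq_or_ne u 0 with rfl | hu
  · simp
  have hu0 : 0 < ‖u‖ := norm_pos_iff.2 hu
  obtain ⟨e, he, hue⟩ : ∃ e : EuclideanSpace ℝ (Fin d), ‖e‖ = 1 ∧ u = ‖u‖ • e :=
    ⟨‖u‖⁻¹ • u, by simp [norm_smul, hu0.ne'], by simp [smul_smul, hu0.ne']⟩
  have hI := integrable_clip hτ0 H.integrable.1
  have hIe : Integrable (fun z => ⟪e, clip τ (h z)⟫) ν := hI.const_inner e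
  have hi : Integrable (fun z => ‖⟪e, clip τ (h z)⟫ - ⟪e, m⟫‖ ^ 2) ν := by
    refine (integrable_norm_clip_sub_sq hτ0 H.integrable.1 m).mono'
      ((hIe.1.sub aestronglyMeasurable_const).norm.pow 2) (ae_of_all _ fun z => ?_)
    rw [Real.norm_of_nonneg (by positivity), ← inner_sub_right]
    gcongr
    simpa [he] using norm_inner_le_norm (𝕜 := ℝ) e (clip τ (h z) - m)
  have key := integral_norm_sub_integral_sq_le hIe ⟪e, m⟫ hi
  have h1 : ∫ z, ⟪u, clip τ (h z) - ∫ z, clip τ (h z) ∂ν⟫ ^ 2 ∂ν =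
      ‖u‖ ^ 2 * ∫ z, ‖⟪e, clip τ (h z)⟫ - ∫ z, ⟪e, clip τ (h z)⟫ ∂ν‖ ^ 2 ∂ν := by
    rw [← integral_const_mul, integral_inner hI]
    congr 1 with z
    conv_lhs => rw [hue, real_inner_smul_left, inner_sub_right]
    rw [mul_pow, Real.norm_eq_abs, sq_abs]
  rw [h1]
  gcongr
  refine key.trans ?_
  have ha := (H.integrable_inner e he).const_mul (2 * (2 * τ) ^ (2 - p))
  have hb := (H.integrable_norm.const_mul ((2 / τ) ^ p)).const_mul (2 * G ^ 2)
  calc ∫ z, ‖⟪e, clip τ (h z)⟫ - ⟪e, m⟫‖ ^ 2 ∂ν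
      ≤ ∫ z, (2 * (2 * τ) ^ (2 - p) * |⟪e, h z - m⟫| ^ p +
          2 * G ^ 2 * ((2 / τ) ^ p * ‖h z - m‖ ^ p)) ∂ν := by
        refine integral_mono hi (ha.add hb) fun z => ?_
        simp only
        rw [Real.norm_eq_abs, sq_abs, ← inner_sub_right]
        exact inner_clip_sub_sq_le hp hp2 hτ hm hG he
    _ = 2 * (2 * τ) ^ (2 - p) * ∫ z, |⟪e, h z - m⟫| ^ p ∂ν +
          2 * G ^ 2 * ((2 / τ) ^ p * ∫ z, ‖h z - m‖ ^ p ∂ν) := by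
        rw [integral_add ha hb, integral_const_mul, integral_const_mul, integral_const_mul]
    _ ≤ 2 * (2 * τ ^ (2 - p)) * σs ^ p + 2 * G ^ 2 * ((4 * τ ^ (-p)) * σl ^ p) := by
        refine add_le_add (mul_le_mul ?_ (H.inner_le e he) (integral_nonneg fun z => ?_)
          (by positivity)) (mul_le_mul_of_nonneg_left (mul_le_mul (two_div_rpow_le hp2 hτ0)
          H.norm_le (integral_nonneg fun z => ?_) (by positivity)) (by positivity))
        · exact mul_le_mul_of_nonneg_left (two_mul_rpow_le hp hτ0) zero_le_two
        · exact Real.rpow_nonneg (abs_nonneg _) _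
        · exact Real.rpow_nonneg (norm_nonneg _) _
    _ = _ := by ring

/-- The bias of a clipped vector. -/
lemma MomentBounds.norm_integral_clip_sub_le (H : MomentBounds ν h m p σs σl) (hp : 1 < p)
    (hp2 : p ≤ 2) (hσs : 0 ≤ σs) (hσl : 0 ≤ σl) (hσ : σs = 0 ↔ σl = 0) (hm : ‖m‖ ≤ G)
    (hG : 2 * G ≤ τ) :
    ‖∫ z, clip τ (h z) ∂ν - m‖ ≤
      5 * (σs * σl ^ (p - 1) * τ ^ (1 - p)) + 4 * (G * (σl ^ p * τ ^ (-p))) := by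
  have hG0 : 0 ≤ G := (norm_nonneg m).trans hm
  have hτ0 : 0 ≤ τ := by linarith
  rcases hτ0.eq_or_lt with rfl | hτ
  · have hm0 : m = 0 := norm_le_zero_iff.1 (by linarith)
    simp only [clip_zero, integral_zero, hm0, sub_zero, norm_zero]
    positivity
  rcases eq_or_ne (∫ z, clip τ (h z) ∂ν - m) 0 with h0 | h0
  · rw [h0, norm_zero]; positivity
  set b := ∫ z, clip τ (h z) ∂ν - m with hb
  have hb0 : 0 < ‖b‖ := norm_pos_iff.2 h0
  obtain ⟨e, he, hbe⟩ : ∃ e : EuclideanSpace ℝ (Fin d), ‖e‖ = 1 ∧ ⟪e, b⟫ = ‖b‖ := by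
    refine ⟨‖b‖⁻¹ • b, by simp [norm_smul, hb0.ne'], ?_⟩
    rw [real_inner_smul_left, real_inner_self_eq_norm_sq]
    field_simp
  have hI := integrable_clip hτ0 H.integrable.1
  -- The unclipped vector has mean m, so the bias is the mean of the clipping error, tested here in
  -- the direction of the bias itself.
  have hbias : ∀ κ : ℝ, 0 < κ →
      ‖b‖ ≤ κ ^ (1 - p) * σs ^ p + (κ + G) * (4 * τ ^ (-p)) * σl ^ p := by
    intro κ hκ
    have ha := (H.integrable_inner e he).const_mul (κ ^ (1 - p))
    have hb := H.integrable_norm.const_mul ((κ + G) * (2 / τ) ^ p)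
    calc ‖b‖ = ∫ z, ⟪e, clip τ (h z) - h z⟫ ∂ν := by
          rw [integral_inner (f := fun z => clip τ (h z) - h z) (hI.sub H.integrable),
            integral_sub hI H.integrable, H.mean, ← hbe]
      _ ≤ ∫ z, (κ ^ (1 - p) * |⟪e, h z - m⟫| ^ p +
            (κ + G) * (2 / τ) ^ p * ‖h z - m‖ ^ p) ∂ν := by
          refine integral_mono ((hI.sub H.integrable).const_inner e) (ha.add hb) fun z => ?_
          exact (le_abs_self _).trans (abs_inner_clip_sub_self_le hp hτ hm hG he hκ)
      _ = κ ^ (1 - p) * ∫ z, |⟪e, h z - m⟫| ^ p ∂ν +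
            (κ + G) * (2 / τ) ^ p * ∫ z, ‖h z - m‖ ^ p ∂ν := by
          rw [integral_add ha hb, integral_const_mul, integral_const_mul]
      _ ≤ _ := by
          refine add_le_add (mul_le_mul_of_nonneg_left (H.inner_le e he) (by positivity))
            (mul_le_mul (mul_le_mul_of_nonneg_left (two_div_rpow_le hp2 hτ0) (by positivity))
              H.norm_le (integral_nonneg fun z => ?_) (by positivity))
          exact Real.rpow_nonneg (norm_nonneg _) _
  rcases hσs.eq_or_lt with hs | hs
  · have hl := hσ.1 hs.symm
    refine (hbias 1 one_pos).trans_eq ?_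
    rw [hl, ← hs, Real.zero_rpow (by linarith)]
    simp
  · have hl : 0 < σl := hσl.lt_of_ne fun h => hs.ne' (hσ.2 h.symm)
    -- This κ makes the two κ-dependent terms equal up to a factor 4, whence the constant 5 = 1 + 4.
    refine (hbias (σs * τ / σl) (by positivity)).trans_eq ?_
    have h1 : (σs * τ / σl) ^ (1 - p) * σs ^ p = σs * σl ^ (p - 1) * τ ^ (1 - p) := by
      rw [Real.div_rpow (by positivity) hσl, Real.mul_rpow hσs hτ0, div_eq_mul_inv,
        ← Real.rpow_neg hσl, neg_sub]
      have : σs ^ (1 - p) * σs ^ p = σs := by rw [← Real.rpow_add hs]; simp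
      linear_combination τ ^ (1 - p) * σl ^ (p - 1) * this
    have h2 : τ * τ ^ (-p) = τ ^ (1 - p) := by
      rw [← Real.rpow_one_add' hτ0 (by linarith)]; rfl
    have h3 : σl ^ p = σl * σl ^ (p - 1) := by
      rw [← Real.rpow_one_add' hσl (by linarith)]; congr 1; ring
    have h4 : σs * τ / σl * (4 * τ ^ (-p)) * σl ^ p = 4 * (σs * σl ^ (p - 1) * τ ^ (1 - p)) := by
      rw [h3, ← h2]; field_simp
    rw [h1, add_mul, add_mul, h4]
    ring

end Moments

end Clip

/-! ### Proximal steps: three-point inequality, nonexpansiveness, descent. -/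

section Prox

variable {d : ℕ} {X : Set (EuclideanSpace ℝ (Fin d))} {f r : EuclideanSpace ℝ (Fin d) → ℝ}
  {gradf : EuclideanSpace ℝ (Fin d) → EuclideanSpace ℝ (Fin d)} {μ G η : ℝ}

/-- The subgradient inequality at the intermediate point is applied to both endpoints; in the convex
combination the inner products cancel. -/
lemma StronglyConvexFirstOrder.le_combo (h : StronglyConvexFirstOrder X μ r) (hX : Convex ℝ X)
    {u y : EuclideanSpace ℝ (Fin d)} (hu : u ∈ X) (hy : y ∈ X) {s : ℝ} (hs : 0 ≤ s)
    (hs1 : s ≤ 1) :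
    r (u + s • (y - u)) ≤ (1 - s) * r u + s * r y - s * (1 - s) * (μ / 2 * ‖y - u‖ ^ 2) := by
  obtain ⟨v, -, hv⟩ := h _ (hX.add_smul_sub_mem hu hy ⟨hs, hs1⟩)
  have h1 := hv u hu
  have h2 := hv y hy
  have e1 : u - (u + s • (y - u)) = -(s • (y - u)) := by abel
  have e2 : y - (u + s • (y - u)) = (1 - s) • (y - u) := by module
  rw [e1, inner_neg_right, inner_smul_right, norm_neg, norm_smul, mul_pow,
    Real.norm_eq_abs, sq_abs] at h1
  rw [e2, inner_smul_right, norm_smul, mul_pow, Real.norm_eq_abs, sq_abs] at h2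
  nlinarith [mul_le_mul_of_nonneg_left h1 (sub_nonneg.2 hs1), mul_le_mul_of_nonneg_left h2 hs]

/-- The three-point inequality of a proximal step. -/
lemma IsProxStep.le {v y u w : EuclideanSpace ℝ (Fin d)} (hX : Convex ℝ X)
    (hr : StronglyConvexFirstOrder X μ r) (h : IsProxStep X r η v y u)
    (hw : w ∈ X) :
    r u + ⟪v, u - w⟫ ≤ r w + (‖w - y‖ ^ 2 - ‖u - y‖ ^ 2 - ‖w - u‖ ^ 2) / (2 * η)
      - μ / 2 * ‖w - u‖ ^ 2 := by
  set A := r w + ⟪v, w - u⟫ + (‖w - y‖ ^ 2 - ‖u - y‖ ^ 2 - ‖w - u‖ ^ 2) / (2 * η)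
      - μ / 2 * ‖w - u‖ ^ 2 - r u with hA
  set K := μ / 2 * ‖w - u‖ ^ 2 + ‖w - u‖ ^ 2 / (2 * η) with hK
  -- Minimality is tested on the segment from u to w, and the inequality is divided by s. The claim
  -- is the limit s → 0.
  have key : ∀ s : ℝ, 0 < s → s ≤ 1 → 0 ≤ A + s * K := by
    intro s hs hs1
    have h1 : r u + ⟪v, u⟫ + ‖u - y‖ ^ 2 / (2 * η) ≤ _ :=
      h.2 (hX.add_smul_sub_mem h.1 hw ⟨hs.le, hs1⟩)
    simp only at h1
    have h2 := hr.le_combo hX h.1 hw hs.le hs1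
    have e1 : ‖u + s • (w - u) - y‖ ^ 2 =
        ‖u - y‖ ^ 2 + s * (‖w - y‖ ^ 2 - ‖u - y‖ ^ 2 - ‖w - u‖ ^ 2) + s ^ 2 * ‖w - u‖ ^ 2 := by
      have e2 : u + s • (w - u) - y = (u - y) + s • (w - u) := by abel
      have e3 : w - y = (u - y) + (w - u) := by abel
      rw [e2, e3, norm_add_sq_real, norm_add_sq_real, inner_smul_right, norm_smul, mul_pow,
        Real.norm_eq_abs, sq_abs]
      ring
    rw [e1, inner_add_right, inner_smul_right] at h1
    have h3 : 0 ≤ s * (A + s * K) := by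
      rw [hA, hK]
      have : (‖u - y‖ ^ 2 + s * (‖w - y‖ ^ 2 - ‖u - y‖ ^ 2 - ‖w - u‖ ^ 2) +
          s ^ 2 * ‖w - u‖ ^ 2) / (2 * η) = ‖u - y‖ ^ 2 / (2 * η) +
          s * ((‖w - y‖ ^ 2 - ‖u - y‖ ^ 2 - ‖w - u‖ ^ 2) / (2 * η)) +
          s ^ 2 * (‖w - u‖ ^ 2 / (2 * η)) := by ring
      nlinarith
    exact nonneg_of_mul_nonneg_right h3 hs
  have hA0 : 0 ≤ A := by
    by_contra hneg
    push Not at hneg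
    have hK0 := key 1 one_pos le_rfl
    have hKpos : 0 < K := by linarith
    -- If A < 0, this s makes s K at most −A/2, which contradicts `key`.
    have h4 := key (min 1 (-A / (2 * K))) (lt_min one_pos (by apply div_pos <;> linarith))
      (min_le_left _ _)
    have h5 : min 1 (-A / (2 * K)) * K ≤ -A / (2 * K) * K := by gcongr; exact min_le_right _ _
    have h6 : -A / (2 * K) * K = -A / 2 := by field_simp
    linarith
  have e : ⟪v, u - w⟫ = -⟪v, w - u⟫ := by rw [← neg_sub, inner_neg_right]
  rw [e]
  linarith

/-- Proximal steps are nonexpansive. -/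
lemma IsProxStep.norm_sub_le {v y u v' y' u' : EuclideanSpace ℝ (Fin d)} (hX : Convex ℝ X)
    (hμ : 0 ≤ μ) (hr : StronglyConvexFirstOrder X μ r) (hη : 0 < η)
    (h : IsProxStep X r η v y u) (h' : IsProxStep X r η v' y' u') :
    ‖u - u'‖ ≤ ‖(y - η • v) - (y' - η • v')‖ := by
  have h1 := h.le hX hr h'.1
  have h2 := h'.le hX hr h.1
  have e1 : ‖u' - y‖ ^ 2 - ‖u - y‖ ^ 2 = ‖u' - u‖ ^ 2 + 2 * ⟪u' - u, u - y⟫ := by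
    have : u' - y = (u' - u) + (u - y) := by abel
    rw [this, norm_add_sq_real]; ring
  have e2 : ‖u - y'‖ ^ 2 - ‖u' - y'‖ ^ 2 = ‖u' - u‖ ^ 2 - 2 * ⟪u' - u, u' - y'⟫ := by
    have : u - y' = (u' - y') - (u' - u) := by abel
    rw [this, norm_sub_sq_real, real_inner_comm]; ring
  have e3 : ‖u - u'‖ = ‖u' - u‖ := norm_sub_rev _ _
  rw [e1, real_inner_comm] at h1
  rw [e2, e3] at h2
  have e4 : ⟪v', u' - u⟫ = ⟪u' - u, v'⟫ := real_inner_comm _ _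
  have e5 : ⟪u - u', v⟫ = -⟪u' - u, v⟫ := by rw [← neg_sub, inner_neg_left]
  rw [e4] at h2
  rw [e5] at h1
  -- Firm nonexpansiveness: in the sum of the two three-point inequalities the values of r cancel,
  -- and the strong convexity term is dropped.
  have h3 : ‖u' - u‖ ^ 2 ≤ ⟪u' - u, (y' - η • v') - (y - η • v)⟫ := by
    have e6 : ⟪u' - u, (y' - η • v') - (y - η • v)⟫ =
        ⟪u' - u, u' - u⟫ - (⟪u' - u, u' - y'⟫ - ⟪u' - u, u - y⟫)
          + η * (⟪u' - u, v⟫ - ⟪u' - u, v'⟫) := by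
      simp only [inner_sub_right, inner_smul_right]; ring
    rw [e6, real_inner_self_eq_norm_sq]
    have h4 : 0 ≤ μ / 2 * ‖u' - u‖ ^ 2 := by positivity
    have h5 : ⟪u' - u, v'⟫ - ⟪u' - u, v⟫ ≤ (⟪u' - u, u - y⟫ - ⟪u' - u, u' - y'⟫) / η := by
      have a1 : (‖u' - u‖ ^ 2 + 2 * ⟪u' - u, u - y⟫ - ‖u' - u‖ ^ 2) / (2 * η) =
        ⟪u' - u, u - y⟫ / η := by field_simp; ring
      have a2 : (‖u' - u‖ ^ 2 - 2 * ⟪u' - u, u' - y'⟫ - ‖u' - u‖ ^ 2) / (2 * η) =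
        - (⟪u' - u, u' - y'⟫ / η) := by field_simp; ring
      rw [a1] at h1
      rw [a2] at h2
      rw [sub_div]
      linarith
    rw [le_div_iff₀ hη] at h5
    linarith
  rcases eq_or_ne (‖u' - u‖) 0 with h0 | h0
  · rw [e3, h0]; positivity
  · have h4 := h3.trans (real_inner_le_norm _ _)
    rw [sq] at h4
    rw [e3, norm_sub_rev (y - η • v)]
    exact le_of_mul_le_mul_left h4 (lt_of_le_of_ne (norm_nonneg _) h0.symm)

/-- One step of proximal SGD with the gradient estimate `c + u`. -/
lemma IsProxStep.descent {xs y y' c u : EuclideanSpace ℝ (Fin d)} (hX : Convex ℝ X) (hμ : 0 < μ)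
    (hr : StronglyConvexFirstOrder X μ r) (hη : 0 < η) (hη6 : η ≤ 6 / μ)
    (hf : ∀ y ∈ X, gradf y ∈ subdifferential f y) (hG : ∀ y ∈ X, ‖gradf y‖ ≤ G)
    (hxs : xs ∈ X) (hy : y ∈ X) (h : IsProxStep X r η (c + u) y y') :
    (f y' + r y') - (f xs + r xs) ≤ -⟪u, y - xs⟫ + μ / 16 * ‖y - xs‖ ^ 2
      + 16 / μ * ‖c - gradf y‖ ^ 2 + 4 * η * G ^ 2 + 2 * η * ‖u‖ ^ 2
      + (1 / (2 * η)) * ‖y - xs‖ ^ 2 - (1 / (2 * η) + μ / 2) * ‖y' - xs‖ ^ 2 := by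
  have h1 := h.le hX hr hxs
  have h2 := hf y hy xs
  have h3 := hf y' h.1 y
  set b := c - gradf y with hb
  have hG0 : 0 ≤ G := (norm_nonneg _).trans (hG y hy)
  have e1 : ⟪c + u, y' - xs⟫ = ⟪gradf y, y - xs⟫ + ⟪b, y - xs⟫ + ⟪u, y - xs⟫
      + ⟪gradf y + b + u, y' - y⟫ := by
    have : c = gradf y + b := by rw [hb]; abel
    have e : y' - xs = (y - xs) + (y' - y) := by abel
    rw [this, e, inner_add_right, inner_add_left, inner_add_left]
  have e2 : ⟪gradf y, xs - y⟫ = -⟪gradf y, y - xs⟫ := by rw [← neg_sub, inner_neg_right]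
  rw [e1] at h1
  rw [e2] at h2
  have n1 : -⟪gradf y + b + u, y' - y⟫ ≤ (G + ‖b‖ + ‖u‖) * ‖y' - y‖ := by
    refine (neg_le_abs _).trans ((abs_real_inner_le_norm _ _).trans ?_)
    gcongr
    exact norm_add₃_le.trans (by linarith [hG y hy])
  have n2 : -⟪gradf y', y - y'⟫ ≤ G * ‖y' - y‖ := by
    refine (neg_le_abs _).trans ((abs_real_inner_le_norm _ _).trans ?_)
    rw [norm_sub_rev]
    gcongr
    exact hG y' h.1
  have n3 : -⟪b, y - xs⟫ ≤ ‖b‖ * ‖y - xs‖ :=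
    (neg_le_abs _).trans (abs_real_inner_le_norm _ _)
  have q1 : ‖b‖ * ‖y - xs‖ ≤ μ / 16 * ‖y - xs‖ ^ 2 + 4 / μ * ‖b‖ ^ 2 := by
    have : 0 ≤ (μ / 4 * ‖y - xs‖ - 2 * ‖b‖) ^ 2 / μ := by positivity
    have e : (μ / 4 * ‖y - xs‖ - 2 * ‖b‖) ^ 2 / μ =
      μ / 16 * ‖y - xs‖ ^ 2 + 4 / μ * ‖b‖ ^ 2 - ‖b‖ * ‖y - xs‖ := by field_simp; ring
    linarith
  -- The square ‖y' − y‖²/(2η) is paid for by the negative one in the three-point inequality.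
  have q2 : (2 * G + ‖b‖ + ‖u‖) * ‖y' - y‖ ≤ ‖y' - y‖ ^ 2 / (2 * η)
      + η / 2 * (2 * G + ‖b‖ + ‖u‖) ^ 2 := by
    have : 0 ≤ (‖y' - y‖ - η * (2 * G + ‖b‖ + ‖u‖)) ^ 2 / (2 * η) := by positivity
    have e : (‖y' - y‖ - η * (2 * G + ‖b‖ + ‖u‖)) ^ 2 / (2 * η) = ‖y' - y‖ ^ 2 / (2 * η)
      + η / 2 * (2 * G + ‖b‖ + ‖u‖) ^ 2 - (2 * G + ‖b‖ + ‖u‖) * ‖y' - y‖ := by field_simp; ring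
    linarith
  have q3 : η / 2 * (2 * G + ‖b‖ + ‖u‖) ^ 2 ≤
      4 * η * G ^ 2 + 2 * η * ‖b‖ ^ 2 + 2 * η * ‖u‖ ^ 2 := by
    have : (2 * G + ‖b‖ + ‖u‖) ^ 2 ≤ 8 * G ^ 2 + 4 * ‖b‖ ^ 2 + 4 * ‖u‖ ^ 2 := by
      nlinarith [sq_nonneg (‖b‖ - ‖u‖), sq_nonneg (2 * G - (‖b‖ + ‖u‖))]
    nlinarith
  -- Here η ≤ 6/μ is used; 12/μ and the 4/μ of `q1` make up the 16/μ of the statement.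
  have q4 : 2 * η * ‖b‖ ^ 2 ≤ 12 / μ * ‖b‖ ^ 2 := by
    gcongr
    calc 2 * η ≤ 2 * (6 / μ) := by gcongr
      _ = 12 / μ := by ring
  have e3 : 16 / μ * ‖b‖ ^ 2 = 4 / μ * ‖b‖ ^ 2 + 12 / μ * ‖b‖ ^ 2 := by ring
  rw [norm_sub_rev xs y, norm_sub_rev xs y'] at h1
  have e4 : (‖y - xs‖ ^ 2 - ‖y' - y‖ ^ 2 - ‖y' - xs‖ ^ 2) / (2 * η) =
    1 / (2 * η) * ‖y - xs‖ ^ 2 - 1 / (2 * η) * ‖y' - xs‖ ^ 2 - ‖y' - y‖ ^ 2 / (2 * η) := by ring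
  rw [e4] at h1
  linarith

end Prox

/-! ### Exponential inequalities for sums driven by independent samples. -/

section Chernoff

variable {Ξ Ω S : Type*} [mΞ : MeasurableSpace Ξ] [MeasurableSpace S] {ξ : ℕ → Ω → Ξ} {T : ℕ}

/-- The `σ`-algebra generated by the samples `ξ s`, `1 ≤ s < t`, `s ≤ T`. -/
abbrev history (ξ : ℕ → Ω → Ξ) (T t : ℕ) : MeasurableSpace Ω :=
  ⨆ i ∈ {i : Set.Icc 1 T | (i : ℕ) < t}, mΞ.comap (ξ i)

lemma history_mono (ξ : ℕ → Ω → Ξ) (T : ℕ) {s t : ℕ} (h : s ≤ t) :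
    history ξ T s ≤ history ξ T t :=
  biSup_mono fun _ hi => lt_of_lt_of_le hi h

lemma measurable_sample (ξ : ℕ → Ω → Ξ) {t : ℕ} (h1 : 1 ≤ t) (hT : t ≤ T) :
    Measurable[history ξ T (t + 1)] (ξ t) := by
  refine Measurable.of_comap_le ?_
  exact le_iSup₂_of_le (f := fun (i : Set.Icc 1 T)
    (_ : i ∈ {i : Set.Icc 1 T | (i : ℕ) < t + 1}) => mΞ.comap (ξ i)) ⟨t, h1, hT⟩
    (Nat.lt_succ_self t) le_rfl

variable [mΩ : MeasurableSpace Ω] {𝒟 : Measure Ξ} {P : Measure Ω}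

lemma history_le (hξ : ∀ t, 1 ≤ t → t ≤ T → Measurable (ξ t)) (t : ℕ) : history ξ T t ≤ mΩ :=
  iSup₂_le fun i _ => (hξ i i.2.1 i.2.2).comap_le

lemma indepFun_of_measurable_history (hξ : ∀ t, 1 ≤ t → t ≤ T → Measurable (ξ t))
    (hind : iIndepFun (fun t : Set.Icc 1 T => ξ t) P) {t : ℕ} (h1 : 1 ≤ t) (hT : t ≤ T)
    {s : Ω → S} (hs : Measurable[history ξ T t] s) : IndepFun s (ξ t) P := by
  have h := indep_iSup_of_disjoint (fun i : Set.Icc 1 T => (hξ i i.2.1 i.2.2).comap_le) hind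
    (S := {i : Set.Icc 1 T | (i : ℕ) < t}) (T := {⟨t, h1, hT⟩})
    (by rw [Set.disjoint_singleton_right]; simp)
  simp only [Set.mem_singleton_iff, iSup_iSup_eq_left] at h
  exact indep_of_indep_of_le_left h hs.comap_le

variable [IsProbabilityMeasure 𝒟] [IsProbabilityMeasure P]

/-- The supermartingale property without conditional expectations: the state s t is a function of
the past, hence independent of ξ t, and the last factor is integrated over 𝒟 with the state frozen.
-/
lemma lintegral_prod_le_one (hξ : ∀ t, 1 ≤ t → t ≤ T → Measurable (ξ t) ∧ P.map (ξ t) = 𝒟)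
    (hind : iIndepFun (fun t : Set.Icc 1 T => ξ t) P) {s : ℕ → Ω → S}
    (hs : ∀ t, 1 ≤ t → t ≤ T → Measurable[history ξ T t] (s t)) {K : ℕ → S → Ξ → ℝ≥0∞}
    (hK : ∀ t, Measurable fun q : S × Ξ => K t q.1 q.2)
    (h1 : ∀ t, 1 ≤ t → t ≤ T → ∀ ω, ∫⁻ z, K t (s t ω) z ∂𝒟 ≤ 1) :
    ∫⁻ ω, ∏ t ∈ Finset.Icc 1 T, K t (s t ω) (ξ t ω) ∂P ≤ 1 := by
  have hle : ∀ t, history ξ T t ≤ mΩ := history_le fun t h1 h2 => (hξ t h1 h2).1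
  suffices H : ∀ n, n ≤ T →
      Measurable[history ξ T (n + 1)] (fun ω => ∏ t ∈ Finset.Icc 1 n, K t (s t ω) (ξ t ω)) ∧
      ∫⁻ ω, ∏ t ∈ Finset.Icc 1 n, K t (s t ω) (ξ t ω) ∂P ≤ 1 from (H T le_rfl).2
  intro n
  induction n with
  | zero => intro _; simp
  | succ n ih =>
    intro hn
    obtain ⟨hm, hi⟩ := ih (by omega)
    have ht1 : 1 ≤ n + 1 := by omega
    simp only [Finset.prod_Icc_succ_top ht1]
    set M := fun ω => ∏ t ∈ Finset.Icc 1 n, K t (s t ω) (ξ t ω) with hM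
    have hsn := hs (n + 1) ht1 hn
    constructor
    · refine (hm.mono (history_mono ξ T (Nat.le_succ _)) le_rfl).mul ?_
      exact (hK (n + 1)).comp ((hsn.mono (history_mono ξ T (Nat.le_succ _)) le_rfl).prodMk
        (measurable_sample ξ ht1 hn))
    -- The partial product and the new state are kept as one pair, because both depend on the past
    -- and only their joint law with the new sample is a product.
    · have hpair : Measurable[history ξ T (n + 1)] (fun ω => (M ω, s (n + 1) ω)) := hm.prodMk hsn
      have hind' := indepFun_of_measurable_history (fun t h1 h2 => (hξ t h1 h2).1) hind ht1 hn hpair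
      have hξn := hξ (n + 1) ht1 hn
      have hpair' := hpair.mono (hle _) le_rfl
      have hlaw := (indepFun_iff_map_prod_eq_prod_map_map hpair'.aemeasurable
        hξn.1.aemeasurable).1 hind'
      rw [hξn.2] at hlaw
      have hfun : Measurable fun q : (ℝ≥0∞ × S) × Ξ => q.1.1 * K (n + 1) q.1.2 q.2 := by
        have := (hK (n + 1)).comp ((measurable_snd.comp measurable_fst).prodMk measurable_snd :
          Measurable fun q : (ℝ≥0∞ × S) × Ξ => (q.1.2, q.2))
        exact (measurable_fst.comp measurable_fst).mul this
      calc ∫⁻ ω, M ω * K (n + 1) (s (n + 1) ω) (ξ (n + 1) ω) ∂P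
          = ∫⁻ q, q.1.1 * K (n + 1) q.1.2 q.2
              ∂(P.map fun ω => ((M ω, s (n + 1) ω), ξ (n + 1) ω)) :=
            (lintegral_map hfun (hpair'.prodMk hξn.1)).symm
        _ = ∫⁻ a, ∫⁻ z, a.1 * K (n + 1) a.2 z ∂𝒟 ∂(P.map fun ω => (M ω, s (n + 1) ω)) := by
            rw [hlaw, lintegral_prod _ hfun.aemeasurable]
        _ = ∫⁻ ω, ∫⁻ z, M ω * K (n + 1) (s (n + 1) ω) z ∂𝒟 ∂P :=
            lintegral_map hfun.lintegral_prod_right' hpair'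
        _ ≤ ∫⁻ ω, M ω ∂P := by
            refine lintegral_mono fun ω => ?_
            have hKz : Measurable fun z => K (n + 1) (s (n + 1) ω) z :=
              (hK (n + 1)).comp measurable_prodMk_left
            rw [lintegral_const_mul _ hKz]
            exact mul_le_of_le_one_right' (h1 _ ht1 hn ω)
        _ ≤ 1 := hi

/-- A Chernoff bound for sums whose increments have, given the past, exponential moment at most
`1`. -/
lemma measure_sum_gt_le (hξ : ∀ t, 1 ≤ t → t ≤ T → Measurable (ξ t) ∧ P.map (ξ t) = 𝒟)
    (hind : iIndepFun (fun t : Set.Icc 1 T => ξ t) P) {s : ℕ → Ω → S}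
    (hs : ∀ t, 1 ≤ t → t ≤ T → Measurable[history ξ T t] (s t)) {Y : ℕ → S → Ξ → ℝ}
    (hY : ∀ t, Measurable fun q : S × Ξ => Y t q.1 q.2) {Λ : ℝ} (hΛ : 0 < Λ) (L : ℝ)
    (h1 : ∀ t, 1 ≤ t → t ≤ T → ∀ ω,
      ∫⁻ z, ENNReal.ofReal (Real.exp (Y t (s t ω) z / Λ)) ∂𝒟 ≤ 1) :
    P {ω | Λ * L < ∑ t ∈ Finset.Icc 1 T, Y t (s t ω) (ξ t ω)} ≤
      ENNReal.ofReal (Real.exp (-L)) := by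
  have hK : ∀ t, Measurable fun q : S × Ξ => ENNReal.ofReal (Real.exp (Y t q.1 q.2 / Λ)) :=
    fun t => ((hY t).div_const Λ).exp.ennreal_ofReal
  have hE := lintegral_prod_le_one hξ hind hs
    (K := fun t a z => ENNReal.ofReal (Real.exp (Y t a z / Λ))) hK h1
  have hle : ∀ t, history ξ T t ≤ mΩ := history_le fun t h1 h2 => (hξ t h1 h2).1
  have hmeas : Measurable fun ω =>
      ∏ t ∈ Finset.Icc 1 T, ENNReal.ofReal (Real.exp (Y t (s t ω) (ξ t ω) / Λ)) := by
    refine Finset.measurable_fun_prod _ fun t ht => ?_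
    rw [Finset.mem_Icc] at ht
    exact (hK t).comp (((hs t ht.1 ht.2).mono (hle t) le_rfl).prodMk (hξ t ht.1 ht.2).1)
  have hmarkov := mul_meas_ge_le_lintegral (μ := P) hmeas (ENNReal.ofReal (Real.exp L))
  have hsub : {ω | Λ * L < ∑ t ∈ Finset.Icc 1 T, Y t (s t ω) (ξ t ω)} ⊆
      {ω | ENNReal.ofReal (Real.exp L) ≤
        ∏ t ∈ Finset.Icc 1 T, ENNReal.ofReal (Real.exp (Y t (s t ω) (ξ t ω) / Λ))} := by
    intro ω hω
    simp only [Set.mem_ofPred_eq] at hω ⊢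
    rw [← ENNReal.ofReal_prod_of_nonneg fun _ _ => (Real.exp_pos _).le, ← Real.exp_sum]
    refine ENNReal.ofReal_le_ofReal (Real.exp_le_exp.2 ?_)
    rw [← Finset.sum_div, le_div_iff₀ hΛ]
    linarith
  have hpos : ENNReal.ofReal (Real.exp L) ≠ 0 := by simp [Real.exp_pos]
  rw [Real.exp_neg, ENNReal.ofReal_inv_of_pos (Real.exp_pos L)]
  refine (measure_mono hsub).trans ?_
  rw [ENNReal.le_inv_iff_mul_le, mul_comm]
  exact hmarkov.trans hE

/-- By 1 + q ≤ e^q, the compensator q cancels the growth of the exponential moment. Both Chernoff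
bounds differ only in the elementary majorant 1 + Y of the exponential. -/
lemma lintegral_exp_sub_le_one {B Y : Ξ → ℝ} {q : ℝ} (hY : Integrable Y 𝒟)
    (hexp : ∀ z, Real.exp (B z) ≤ 1 + Y z) (hq : ∫ z, Y z ∂𝒟 ≤ q) :
    ∫⁻ z, ENNReal.ofReal (Real.exp (B z - q)) ∂𝒟 ≤ 1 := by
  have hle : ∀ z, Real.exp (B z - q) ≤ Real.exp (-q) * (1 + Y z) := fun z => by
    rw [sub_eq_neg_add, Real.exp_add]
    gcongr
    exact hexp z
  have hi : Integrable (fun z => Real.exp (-q) * (1 + Y z)) 𝒟 :=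
    ((integrable_const 1).add hY).const_mul _
  calc ∫⁻ z, ENNReal.ofReal (Real.exp (B z - q)) ∂𝒟
      ≤ ∫⁻ z, ENNReal.ofReal (Real.exp (-q) * (1 + Y z)) ∂𝒟 :=
        lintegral_mono fun z => ENNReal.ofReal_le_ofReal (hle z)
    _ = ENNReal.ofReal (∫ z, Real.exp (-q) * (1 + Y z) ∂𝒟) :=
        (ofReal_integral_eq_lintegral_ofReal hi
          (ae_of_all _ fun z => (Real.exp_pos _).le.trans (hle z))).symm
    _ ≤ 1 := by
        rw [integral_const_mul, integral_add (integrable_const 1) hY, integral_const,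
          probReal_univ, one_smul, ENNReal.ofReal_le_one]
        calc Real.exp (-q) * (1 + ∫ z, Y z ∂𝒟) ≤ Real.exp (-q) * Real.exp q := by
              gcongr
              linarith [Real.add_one_le_exp q]
          _ = 1 := by rw [← Real.exp_add]; simp

/-- Bernstein's inequality for martingale differences bounded by `Λ`, with conditional variances
at most `Λ q`. -/
lemma measure_sum_sub_gt_le (hξ : ∀ t, 1 ≤ t → t ≤ T → Measurable (ξ t) ∧ P.map (ξ t) = 𝒟)
    (hind : iIndepFun (fun t : Set.Icc 1 T => ξ t) P) {s : ℕ → Ω → S}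
    (hs : ∀ t, 1 ≤ t → t ≤ T → Measurable[history ξ T t] (s t)) {W : ℕ → S → Ξ → ℝ}
    (hW : ∀ t, Measurable fun q : S × Ξ => W t q.1 q.2) {q : ℕ → S → ℝ}
    (hq : ∀ t, Measurable (q t)) {Λ : ℝ} (hΛ : 0 ≤ Λ) (L : ℝ)
    (hq0 : ∀ t, 1 ≤ t → t ≤ T → ∀ ω, 0 ≤ q t (s t ω))
    (hb : ∀ t, 1 ≤ t → t ≤ T → ∀ ω z, |W t (s t ω) z| ≤ Λ)
    (hmean : ∀ t, 1 ≤ t → t ≤ T → ∀ ω, ∫ z, W t (s t ω) z ∂𝒟 = 0)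
    (hvar : ∀ t, 1 ≤ t → t ≤ T → ∀ ω, ∫ z, W t (s t ω) z ^ 2 ∂𝒟 ≤ Λ * q t (s t ω)) :
    P {ω | Λ * L < ∑ t ∈ Finset.Icc 1 T, (W t (s t ω) (ξ t ω) - q t (s t ω))} ≤
      ENNReal.ofReal (Real.exp (-L)) := by
  rcases hΛ.eq_or_lt with rfl | hΛ
  -- For Λ = 0 the quotient by Λ carries no information, but then the increments vanish.
  · refine (measure_mono_null (fun ω hω => ?_) measure_empty).le.trans zero_le
    simp only [zero_mul, Set.mem_ofPred_eq] at hω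
    refine hω.not_ge (Finset.sum_nonpos fun t ht => ?_)
    rw [Finset.mem_Icc] at ht
    have h1 := abs_nonpos_iff.1 (hb t ht.1 ht.2 ω (ξ t ω))
    linarith [hq0 t ht.1 ht.2 ω]
  refine measure_sum_gt_le hξ hind hs (Y := fun t a z => W t a z - q t a)
    (fun t => (hW t).sub ((hq t).comp measurable_fst)) hΛ L fun t h1 h2 ω => ?_
  have hWm : Measurable (W t (s t ω)) := (hW t).comp measurable_prodMk_left
  have hWi : Integrable (W t (s t ω)) 𝒟 :=
    Integrable.of_bound hWm.aestronglyMeasurable Λ (ae_of_all _ (hb t h1 h2 ω))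
  have hW2i : Integrable (fun z => W t (s t ω) z ^ 2) 𝒟 := by
    refine Integrable.of_bound (hWm.pow_const 2).aestronglyMeasurable (Λ ^ 2) (ae_of_all _ fun z => ?_)
    rw [Real.norm_eq_abs, abs_pow]
    exact pow_le_pow_left₀ (abs_nonneg _) (hb t h1 h2 ω z) 2
  simp_rw [sub_div]
  have hi1 := hWi.div_const Λ
  have hi2 := hW2i.div_const (Λ ^ 2)
  refine lintegral_exp_sub_le_one (Y := fun z => W t (s t ω) z / Λ + W t (s t ω) z ^ 2 / Λ ^ 2)
    (hi1.add hi2) (fun z => ?_) ?_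
  -- The majorant is e^x ≤ 1 + x + x² for |x| ≤ 1; the linear term integrates to zero.
  · have hx : |W t (s t ω) z / Λ| ≤ 1 := by
      rw [abs_div, abs_of_pos hΛ, div_le_one hΛ]
      exact hb t h1 h2 ω z
    have := (le_abs_self _).trans (Real.abs_exp_sub_one_sub_id_le hx)
    rw [div_pow] at this
    linarith
  · rw [integral_add hi1 hi2, integral_div, integral_div, hmean t h1 h2 ω, zero_div, zero_add,
      div_le_div_iff₀ (by positivity) hΛ]
    nlinarith [hvar t h1 h2 ω]

lemma exp_le_one_add_two_mul {x : ℝ} (h0 : 0 ≤ x) (h1 : x ≤ 1) : Real.exp x ≤ 1 + 2 * x := by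
  have := (le_abs_self _).trans (Real.abs_exp_sub_one_sub_id_le (abs_le.2 ⟨by linarith, h1⟩))
  nlinarith

/-- A one-sided bound for sums of nonnegative variables at most `Λ`. -/
lemma measure_sum_nonneg_gt_le (hξ : ∀ t, 1 ≤ t → t ≤ T → Measurable (ξ t) ∧ P.map (ξ t) = 𝒟)
    (hind : iIndepFun (fun t : Set.Icc 1 T => ξ t) P) {s : ℕ → Ω → S}
    (hs : ∀ t, 1 ≤ t → t ≤ T → Measurable[history ξ T t] (s t)) {V : ℕ → S → Ξ → ℝ}
    (hV : ∀ t, Measurable fun q : S × Ξ => V t q.1 q.2) {m : ℕ → ℝ} {Λ : ℝ} (hΛ : 0 ≤ Λ)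
    (L : ℝ) (hm0 : ∀ t, 1 ≤ t → t ≤ T → 0 ≤ m t)
    (hV0 : ∀ t, 1 ≤ t → t ≤ T → ∀ ω z, 0 ≤ V t (s t ω) z)
    (hb : ∀ t, 1 ≤ t → t ≤ T → ∀ ω z, V t (s t ω) z ≤ Λ)
    (hmean : ∀ t, 1 ≤ t → t ≤ T → ∀ ω, ∫ z, V t (s t ω) z ∂𝒟 ≤ m t) :
    P {ω | Λ * L < ∑ t ∈ Finset.Icc 1 T, (V t (s t ω) (ξ t ω) - 2 * m t)} ≤
      ENNReal.ofReal (Real.exp (-L)) := by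
  rcases hΛ.eq_or_lt with rfl | hΛ
  · refine (measure_mono_null (fun ω hω => ?_) measure_empty).le.trans zero_le
    simp only [zero_mul, Set.mem_ofPred_eq] at hω
    refine hω.not_ge (Finset.sum_nonpos fun t ht => ?_)
    rw [Finset.mem_Icc] at ht
    linarith [hb t ht.1 ht.2 ω (ξ t ω), hm0 t ht.1 ht.2]
  refine measure_sum_gt_le hξ hind hs (Y := fun t a z => V t a z - 2 * m t)
    (fun t => (hV t).sub_const _) hΛ L fun t h1 h2 ω => ?_
  have hVm : Measurable (V t (s t ω)) := (hV t).comp measurable_prodMk_left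
  have hVi : Integrable (V t (s t ω)) 𝒟 :=
    Integrable.of_bound hVm.aestronglyMeasurable Λ (ae_of_all _ fun z => by
      rw [Real.norm_of_nonneg (hV0 t h1 h2 ω z)]; exact hb t h1 h2 ω z)
  simp_rw [sub_div]
  refine lintegral_exp_sub_le_one (Y := fun z => 2 * (V t (s t ω) z / Λ))
    ((hVi.div_const Λ).const_mul 2) (fun z => ?_) ?_
  · exact exp_le_one_add_two_mul (div_nonneg (hV0 t h1 h2 ω z) hΛ.le)
      ((div_le_one hΛ).2 (hb t h1 h2 ω z))
  · rw [integral_const_mul, integral_div, ← mul_div_assoc]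
    gcongr
    exact hmean t h1 h2 ω


end Chernoff

/-! ### Inequalities for τ⋆, φ⋆ and φ. -/

section Parameters

variable {p σs σl δ : ℝ}

lemma one_le_log_three_div (hδ : 0 < δ) (hδ1 : δ ≤ 1) : 1 ≤ Real.log (3 / δ) := by
  rw [Real.le_log_iff_exp_le (by positivity)]
  have h1 : (3 : ℝ) ≤ 3 / δ := by rw [le_div_iff₀ hδ]; linarith
  linarith [Real.exp_one_lt_d9]

lemma tauStar_nonneg (hs : 0 ≤ σs) (hl : 0 ≤ σl) (hδ : 0 < δ) (hδ1 : δ ≤ 1) :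
    0 ≤ tauStar p σs σl δ := by
  have hL := one_le_log_three_div hδ hδ1
  unfold tauStar
  apply Real.rpow_nonneg
  split_ifs <;> positivity

lemma tauStar_zero (hp : 1 < p) (δ : ℝ) : tauStar p 0 0 δ = 0 := by
  unfold tauStar
  split_ifs <;> simp [Real.zero_rpow (by linarith : p - 1 ≠ 0), Real.zero_rpow (inv_ne_zero (by linarith : p ≠ 0))]

lemma phiStar_nonneg (hδ : 0 < δ) (hδ1 : δ ≤ 1) : 0 ≤ phiStar p σs σl δ := by
  have hL := one_le_log_three_div hδ hδ1
  exact le_max_of_le_left (by positivity)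

/-- The logarithm of `τ⋆` is the minimum of two linear expressions in the logarithms of the
parameters. -/
lemma log_tauStar (hp : 1 < p) (hs : 0 < σs) (hl : 0 < σl) (hδ : 0 < δ) (hδ1 : δ ≤ 1) :
    0 < tauStar p σs σl δ ∧
    p * Real.log (tauStar p σs σl δ) ≤
      Real.log σs + (p - 1) * Real.log σl - Real.log (Real.log (3 / δ)) ∧
    (p < 2 → p * Real.log (tauStar p σs σl δ) ≤ 2 * Real.log σs - (2 - p) * Real.log σl) ∧
    (p * Real.log (tauStar p σs σl δ) =
        Real.log σs + (p - 1) * Real.log σl - Real.log (Real.log (3 / δ)) ∨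
      p < 2 ∧ p * Real.log (tauStar p σs σl δ) = 2 * Real.log σs - (2 - p) * Real.log σl) := by
  have hL : 0 < Real.log (3 / δ) := one_pos.trans_le (one_le_log_three_div hδ hδ1)
  have hA : 0 < σs * σl ^ (p - 1) / Real.log (3 / δ) := by positivity
  have hB : 0 < σs ^ 2 / σl ^ (2 - p) := by positivity
  have hlA : Real.log (σs * σl ^ (p - 1) / Real.log (3 / δ)) =
      Real.log σs + (p - 1) * Real.log σl - Real.log (Real.log (3 / δ)) := by
    rw [Real.log_div (by positivity) hL.ne', Real.log_mul hs.ne' (by positivity),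
      Real.log_rpow hl]
  have hlB : Real.log (σs ^ 2 / σl ^ (2 - p)) = 2 * Real.log σs - (2 - p) * Real.log σl := by
    rw [Real.log_div (by positivity) (by positivity), Real.log_pow, Real.log_rpow hl]
    norm_num
  have hp0 : p ≠ 0 := by linarith
  have hlog : ∀ x : ℝ, 0 < x → p * Real.log (x ^ (1 / p)) = Real.log x := fun x hx => by
    rw [Real.log_rpow hx]; field_simp
  unfold tauStar
  split_ifs with h2
  · have hm := lt_min hA hB
    rw [hlog _ hm, ← hlA, ← hlB]
    refine ⟨by positivity, Real.log_le_log hm (min_le_left _ _),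
      fun _ => Real.log_le_log hm (min_le_right _ _), ?_⟩
    rcases min_choice (σs * σl ^ (p - 1) / Real.log (3 / δ)) (σs ^ 2 / σl ^ (2 - p)) with h | h
    · left; rw [h]
    · right; exact ⟨h2, by rw [h]⟩
  · rw [hlog _ hA, hlA]
    exact ⟨by positivity, le_rfl, fun h => absurd h h2, Or.inl rfl⟩

/-- Both sides are monomials, so after taking logarithms the claim is linear; it is a multiple of
the inequality τ⋆^p ≤ σs²/σl^(2−p). The relation p q = 1 with q = 1/p clears the fractional
exponents. The next estimates follow the same pattern. -/
lemma large_rpow_mul_tauStar_rpow_le (hp : 1 < p) (hp2 : p ≤ 2) (hs : 0 ≤ σs) (hsl : σs ≤ σl)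
    (h0 : σs = 0 → σl = 0) (hδ : 0 < δ) (hδ1 : δ ≤ 1) :
    σl ^ p * tauStar p σs σl δ ^ (2 - p) ≤ σs ^ (4 / p - 2) * σl ^ (4 - 4 / p) := by
  have hl0 := hs.trans hsl
  rcases hs.eq_or_lt with hs' | hs'
  · rw [h0 hs'.symm, Real.zero_rpow (by linarith), zero_mul]; positivity
  have hl := hs'.trans_le hsl
  obtain ⟨ht, -, h2, -⟩ := log_tauStar hp hs' hl hδ hδ1
  rcases hp2.eq_or_lt with rfl | hp2'
  · norm_num
  have h := h2 hp2'
  set t := Real.log (tauStar p σs σl δ)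
  set a := Real.log σs with ha
  set b := Real.log σl with hb
  obtain ⟨q, hq⟩ : ∃ q, q = 1 / p := ⟨_, rfl⟩
  have hpq : p * q = 1 := by rw [hq]; field_simp
  have hq0 : 0 < q := by rw [hq]; positivity
  have e4 : 4 / p = 4 * q := by rw [hq]; ring
  rw [e4, Real.rpow_def_of_pos hl, Real.rpow_def_of_pos ht, Real.rpow_def_of_pos hs',
    Real.rpow_def_of_pos hl, ← Real.exp_add, ← Real.exp_add, Real.exp_le_exp, ← ha, ← hb]
  have h3 := mul_le_mul_of_nonneg_left h (mul_nonneg (sub_nonneg.2 hp2) hq0.le)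
  linear_combination h3 - (2 * a - 4 * b + p * b + (2 - p) * t) * hpq

lemma sq_log_mul_sq_tauStar_le (hp : 1 < p) (hs : 0 ≤ σs) (hsl : σs ≤ σl)
    (h0 : σs = 0 → σl = 0) (hδ : 0 < δ) (hδ1 : δ ≤ 1) :
    Real.log (3 / δ) ^ 2 * tauStar p σs σl δ ^ 2 ≤
      σs ^ (2 / p) * σl ^ (2 - 2 / p) * Real.log (3 / δ) ^ (2 - 2 / p) := by
  have hl0 := hs.trans hsl
  have hL : 0 < Real.log (3 / δ) := one_pos.trans_le (one_le_log_three_div hδ hδ1)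
  rcases hs.eq_or_lt with hs' | hs'
  · rw [h0 hs'.symm, ← hs', tauStar_zero hp]
    norm_num
    positivity
  have hl := hs'.trans_le hsl
  obtain ⟨ht, h, -, -⟩ := log_tauStar hp hs' hl hδ hδ1
  set t := Real.log (tauStar p σs σl δ)
  set a := Real.log σs with ha
  set b := Real.log σl with hb
  set c := Real.log (Real.log (3 / δ)) with hc
  obtain ⟨q, hq⟩ : ∃ q, q = 1 / p := ⟨_, rfl⟩
  have hpq : p * q = 1 := by rw [hq]; field_simp
  have hq0 : 0 < q := by rw [hq]; positivity
  have e2 : 2 / p = 2 * q := by rw [hq]; ring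
  rw [e2, ← Real.rpow_two, ← Real.rpow_two, Real.rpow_def_of_pos hL, Real.rpow_def_of_pos ht,
    Real.rpow_def_of_pos hs', Real.rpow_def_of_pos hl, Real.rpow_def_of_pos hL, ← Real.exp_add,
    ← Real.exp_add, ← Real.exp_add, Real.exp_le_exp, ← ha, ← hb, ← hc]
  have h3 := mul_le_mul_of_nonneg_left h (mul_nonneg zero_le_two hq0.le)
  linear_combination h3 + (2 * b - 2 * t) * hpq

/-- This follows from the first entry of the minimum defining τ⋆, together with σs ≤ σl. -/
lemma log_mul_small_rpow_mul_tauStar_rpow_le (hp : 1 < p) (hp2 : p ≤ 2) (hs : 0 ≤ σs)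
    (hsl : σs ≤ σl) (hδ : 0 < δ) (hδ1 : δ ≤ 1) :
    Real.log (3 / δ) * (σs ^ p * tauStar p σs σl δ ^ (2 - p)) ≤
      σs ^ (2 / p) * σl ^ (2 - 2 / p) * Real.log (3 / δ) ^ (2 - 2 / p) := by
  have hl0 := hs.trans hsl
  have hL : 0 < Real.log (3 / δ) := one_pos.trans_le (one_le_log_three_div hδ hδ1)
  rcases hs.eq_or_lt with hs' | hs'
  · rw [← hs', Real.zero_rpow (by linarith : p ≠ 0), zero_mul, mul_zero]
    positivity
  have hl := hs'.trans_le hsl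
  obtain ⟨ht, h, -, -⟩ := log_tauStar hp hs' hl hδ hδ1
  have hab := Real.log_le_log hs' hsl
  set t := Real.log (tauStar p σs σl δ)
  set a := Real.log σs with ha
  set b := Real.log σl with hb
  set c := Real.log (Real.log (3 / δ)) with hc
  obtain ⟨q, hq⟩ : ∃ q, q = 1 / p := ⟨_, rfl⟩
  have hpq : p * q = 1 := by rw [hq]; field_simp
  have hq0 : 0 < q := by rw [hq]; positivity
  have e2 : 2 / p = 2 * q := by rw [hq]; ring
  have e1 : Real.log (3 / δ) = Real.exp c := (Real.exp_log hL).symm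
  rw [e2, Real.rpow_def_of_pos hL, ← hc, e1, Real.rpow_def_of_pos ht,
    Real.rpow_def_of_pos hs', Real.rpow_def_of_pos hs', Real.rpow_def_of_pos hl, ← Real.exp_add,
    ← Real.exp_add, ← Real.exp_add, ← Real.exp_add, Real.exp_le_exp, ← ha, ← hb]
  have h3 := mul_le_mul_of_nonneg_left h (mul_nonneg (sub_nonneg.2 hp2) hq0.le)
  have h4 := mul_le_mul_of_nonneg_left hab (sub_nonneg.2 hp.le)
  linear_combination h3 + h4 + (c - a - (2 - p) * t + (3 - p) * b) * hpq

/-- The exponent 1 − p is negative, so a lower bound on τ⋆ is needed: the minimum is attained, and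
each of its entries produces exactly one of the two summands. -/
lemma sq_bias_tauStar_le (hp : 1 < p) (hs : 0 ≤ σs) (hsl : σs ≤ σl)
    (hδ : 0 < δ) (hδ1 : δ ≤ 1) :
    (σs * σl ^ (p - 1) * tauStar p σs σl δ ^ (1 - p)) ^ 2 ≤
      σs ^ (4 / p - 2) * σl ^ (4 - 4 / p) +
        σs ^ (2 / p) * σl ^ (2 - 2 / p) * Real.log (3 / δ) ^ (2 - 2 / p) := by
  have hl0 := hs.trans hsl
  have hL : 0 < Real.log (3 / δ) := one_pos.trans_le (one_le_log_three_div hδ hδ1)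
  rcases hs.eq_or_lt with hs' | hs'
  · rw [← hs', zero_mul, zero_mul]
    norm_num
    positivity
  have hl := hs'.trans_le hsl
  obtain ⟨ht, -, -, h⟩ := log_tauStar hp hs' hl hδ hδ1
  have e0 : 0 ≤ σs ^ (4 / p - 2) * σl ^ (4 - 4 / p) := by positivity
  have e0' : 0 ≤ σs ^ (2 / p) * σl ^ (2 - 2 / p) * Real.log (3 / δ) ^ (2 - 2 / p) := by positivity
  have e1 : (σs * σl ^ (p - 1) * tauStar p σs σl δ ^ (1 - p)) ^ 2 =
      Real.exp (2 * (Real.log σs + (p - 1) * Real.log σl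
        + (1 - p) * Real.log (tauStar p σs σl δ))) := by
    rw [two_mul, Real.exp_add, ← sq]
    congr 1
    rw [Real.exp_add, Real.exp_add, Real.exp_log hs', Real.rpow_def_of_pos hl,
      Real.rpow_def_of_pos ht, mul_comm (p - 1), mul_comm (1 - p)]
  obtain ⟨q, hq⟩ : ∃ q, q = 1 / p := ⟨_, rfl⟩
  have hpq : p * q = 1 := by rw [hq]; field_simp
  have e2 : 2 / p = 2 * q := by rw [hq]; ring
  have e4 : 4 / p = 4 * q := by rw [hq]; ring
  rw [e1]
  rcases h with h | ⟨-, h⟩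
  · refine (le_of_eq ?_).trans (le_add_of_nonneg_left e0)
    rw [e2, Real.rpow_def_of_pos hL, Real.rpow_def_of_pos hs', Real.rpow_def_of_pos hl,
      ← Real.exp_add, ← Real.exp_add]
    congr 1
    linear_combination 2 * (1 - p) * q * h + (-2 * Real.log σs + (4 - 2 * p) * Real.log σl +
      2 * Real.log (Real.log (3 / δ)) - 2 * (1 - p) * Real.log (tauStar p σs σl δ)) * hpq
  · refine (le_of_eq ?_).trans (le_add_of_nonneg_right e0')
    rw [e4, Real.rpow_def_of_pos hs', Real.rpow_def_of_pos hl, ← Real.exp_add]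
    congr 1
    linear_combination 2 * (1 - p) * q * h + (-4 * Real.log σs + (6 - 2 * p) * Real.log σl
      - 2 * (1 - p) * Real.log (tauStar p σs σl δ)) * hpq

/-- The entry attaining the minimum in τ⋆ makes the left side equal to the corresponding entry of
φ⋆. -/
lemma large_rpow_mul_tauStar_rpow_neg_le (hp : 1 < p) (hs : 0 < σs) (hsl : σs ≤ σl)
    (hδ : 0 < δ) (hδ1 : δ ≤ 1) :
    σl ^ p * tauStar p σs σl δ ^ (-p) ≤ phiStar p σs σl δ := by
  have hl := hs.trans_le hsl
  have hL : 0 < Real.log (3 / δ) := one_pos.trans_le (one_le_log_three_div hδ hδ1)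
  obtain ⟨ht, -, -, h⟩ := log_tauStar hp hs hl hδ hδ1
  have e : σl ^ p * tauStar p σs σl δ ^ (-p) =
      Real.exp (p * Real.log σl - p * Real.log (tauStar p σs σl δ)) := by
    rw [Real.rpow_def_of_pos hl, Real.rpow_def_of_pos ht, ← Real.exp_add]
    congr 1; ring
  unfold phiStar dEff
  rw [e]
  rcases h with h | ⟨h2, h⟩
  · refine le_max_of_le_left (le_of_eq ?_)
    have : p * Real.log σl - p * Real.log (tauStar p σs σl δ) =
      Real.log σl - Real.log σs + Real.log (Real.log (3 / δ)) := by rw [h]; ring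
    rw [this, Real.exp_add, Real.exp_sub, Real.exp_log hl, Real.exp_log hs, Real.exp_log hL,
      ← div_pow, Real.sqrt_sq (by positivity)]
  · refine le_max_of_le_right (le_of_eq ?_)
    have : p * Real.log σl - p * Real.log (tauStar p σs σl δ) =
      2 * (Real.log σl - Real.log σs) := by rw [h]; ring
    rw [this, two_mul, Real.exp_add, Real.exp_sub, Real.exp_log hl, Real.exp_log hs, if_pos h2]
    field_simp

lemma phi_le_phiStar (p σs σl δ G : ℝ) (T : ℕ) : phi p σs σl δ G T ≤ phiStar p σs σl δ := by
  unfold phi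
  split_ifs
  · exact le_rfl
  · exact min_le_left _ _

lemma phi_nonneg (hδ : 0 < δ) (hδ1 : δ ≤ 1) (G : ℝ) (T : ℕ) : 0 ≤ phi p σs σl δ G T := by
  have h := phiStar_nonneg (p := p) (σs := σs) (σl := σl) hδ hδ1
  unfold phi
  split_ifs
  · exact h
  · exact le_min h (Real.sqrt_nonneg _)

lemma phi_eq_phiStar {G : ℝ} {T : ℕ} (hl : 0 ≤ σl) (hG : 0 ≤ G) (hδ : 0 < δ) (hδ1 : δ ≤ 1)
    (hT : 2 ^ p * (G ^ p / σl ^ p) * phiStar p σs σl δ ≤ T) :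
    phi p σs σl δ G T = phiStar p σs σl δ := by
  have h := phiStar_nonneg (p := p) (σs := σs) (σl := σl) hδ hδ1
  unfold phi
  split_ifs with hG0
  · rfl
  have hG' : 0 < G := hG.lt_of_ne' hG0
  refine min_eq_left ?_
  rcases hl.eq_or_lt with rfl | hl'
  · have : phiStar p σs 0 δ = 0 := by simp [phiStar, dEff]
    rw [this]; positivity
  refine Real.le_sqrt_of_sq_le ?_
  have h1 := mul_le_mul_of_nonneg_left hT
    (by positivity : 0 ≤ (1 / 2) ^ p * phiStar p σs σl δ * (σl / G) ^ p)
  refine le_trans (le_of_eq ?_) h1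
  rw [Real.div_rpow hl hG, Real.div_rpow zero_le_one zero_le_two, Real.one_rpow]
  field_simp

/-- The clipping threshold at time `t`. -/
noncomputable def threshold (p σs σl δ G : ℝ) (t : ℕ) : ℝ :=
  max (2 * G) (tauStar p σs σl δ * (t : ℝ) ^ (1 / p))

/-- This explains the form of φ. With ψ = σl^p τ_t^(−p), the growing part of the threshold gives tψ
≤ φ⋆, while 2G gives ψ ≤ 2^(−p)(σl/G)^p. The second entry of φ comes from (tψ)² = (tψ) · ψ · t. -/
lemma mul_large_rpow_mul_threshold_rpow_neg_le {G : ℝ} {T t : ℕ} (hp : 1 < p) (hs : 0 ≤ σs)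
    (hsl : σs ≤ σl) (h0 : σs = 0 → σl = 0) (hG : 0 ≤ G) (hδ : 0 < δ) (hδ1 : δ ≤ 1)
    (ht : 1 ≤ t) (htT : t ≤ T) :
    t * (G * (σl ^ p * threshold p σs σl δ G t ^ (-p))) ≤ G * phi p σs σl δ G T := by
  have hφ := phi_nonneg (p := p) (σs := σs) (σl := σl) hδ hδ1 G T
  have hφs := phiStar_nonneg (p := p) (σs := σs) (σl := σl) hδ hδ1
  rcases hG.eq_or_lt with rfl | hG'
  · simp
  rcases hs.eq_or_lt with hs' | hs'
  · rw [h0 hs'.symm, Real.zero_rpow (by linarith : p ≠ 0)] at *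
    simp only [zero_mul, mul_zero]
    positivity
  have hl := hs'.trans_le hsl
  have ht0 : (0 : ℝ) < t := by exact_mod_cast ht
  have hτs := (log_tauStar hp hs' hl hδ hδ1).1
  set ψ := σl ^ p * threshold p σs σl δ G t ^ (-p) with hψ
  have hth : 0 < threshold p σs σl δ G t := lt_max_of_lt_left (by linarith)
  have hψ0 : 0 ≤ ψ := by positivity
  have h1 : t * ψ ≤ phiStar p σs σl δ := by
    refine le_trans ?_ (large_rpow_mul_tauStar_rpow_neg_le hp hs' hsl hδ hδ1)
    have h2 : threshold p σs σl δ G t ^ (-p) ≤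
        (tauStar p σs σl δ * (t : ℝ) ^ (1 / p)) ^ (-p) :=
      Real.rpow_le_rpow_of_nonpos (by positivity) (le_max_right _ _) (by linarith)
    have h3 : (tauStar p σs σl δ * (t : ℝ) ^ (1 / p)) ^ (-p) =
        tauStar p σs σl δ ^ (-p) * (t : ℝ)⁻¹ := by
      rw [Real.mul_rpow hτs.le (by positivity), ← Real.rpow_mul ht0.le]
      congr 1
      rw [← Real.rpow_neg_one]
      congr 1; field_simp
    rw [h3] at h2
    calc t * ψ ≤ t * (σl ^ p * (tauStar p σs σl δ ^ (-p) * (t : ℝ)⁻¹)) := by rw [hψ]; gcongr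
      _ = σl ^ p * tauStar p σs σl δ ^ (-p) := by field_simp
  have h4 : ψ ≤ (1 / 2) ^ p * (σl / G) ^ p := by
    have h2 : threshold p σs σl δ G t ^ (-p) ≤ (2 * G) ^ (-p) :=
      Real.rpow_le_rpow_of_nonpos (by positivity) (le_max_left _ _) (by linarith)
    calc ψ ≤ σl ^ p * (2 * G) ^ (-p) := by rw [hψ]; gcongr
      _ = (1 / 2) ^ p * (σl / G) ^ p := by
        rw [Real.rpow_neg (by positivity), Real.mul_rpow zero_le_two hG, Real.div_rpow hl.le hG,
          Real.div_rpow zero_le_one zero_le_two, Real.one_rpow]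
        field_simp
  have h5 : t * ψ ≤ phi p σs σl δ G T := by
    unfold phi
    rw [if_neg hG'.ne']
    refine le_min h1 (Real.le_sqrt_of_sq_le ?_)
    have hT : (t : ℝ) ≤ T := by exact_mod_cast htT
    calc (t * ψ) ^ 2 = (t * ψ) * ψ * t := by ring
      _ ≤ phiStar p σs σl δ * ((1 / 2) ^ p * (σl / G) ^ p) * T := by gcongr
      _ = _ := by ring
  calc t * (G * ψ) = G * (t * ψ) := by ring
    _ ≤ _ := by gcongr

end Parameters

/-! ### Every error term against T³ times the rate. -/

section Bounds

variable {p σs σl δ G μ D : ℝ} {T t : ℕ}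

/-- The bias bound at time `t`. -/
noncomputable def biasBound (p σs σl δ G : ℝ) (t : ℕ) : ℝ :=
  5 * (σs * σl ^ (p - 1) * threshold p σs σl δ G t ^ (1 - p))
    + 4 * (G * (σl ^ p * threshold p σs σl δ G t ^ (-p)))

/-- The bound of the variance along a direction at time `t`. -/
noncomputable def directionalBound (p σs σl δ G : ℝ) (t : ℕ) : ℝ :=
  4 * threshold p σs σl δ G t ^ (2 - p) * σs ^ p
    + 8 * G ^ 2 * threshold p σs σl δ G t ^ (-p) * σl ^ p

lemma sq_threshold_le (p σs σl δ G : ℝ) (t : ℕ) : threshold p σs σl δ G t ^ 2 ≤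
    4 * G ^ 2 + tauStar p σs σl δ ^ 2 * (t : ℝ) ^ (2 / p) := by
  have e : ((t : ℝ) ^ (1 / p)) ^ 2 = (t : ℝ) ^ (2 / p) := by
    rw [← Real.rpow_natCast, ← Real.rpow_mul (Nat.cast_nonneg t)]
    congr 1; push_cast; ring
  have h2 : 0 ≤ tauStar p σs σl δ ^ 2 * (t : ℝ) ^ (2 / p) := by positivity
  unfold threshold
  rcases max_choice (2 * G) (tauStar p σs σl δ * (t : ℝ) ^ (1 / p)) with h | h <;> rw [h, mul_pow]
  · linarith
  · rw [e]; linarith [sq_nonneg G]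

/-- The conditions on the parameters, except for the positivity of `μ`. -/
structure Admissible (p σs σl δ G : ℝ) : Prop where
  one_lt : 1 < p
  le_two : p ≤ 2
  small_nonneg : 0 ≤ σs
  small_le_large : σs ≤ σl
  large_eq_zero : σs = 0 → σl = 0
  delta_pos : 0 < δ
  delta_le_one : δ ≤ 1
  bound_nonneg : 0 ≤ G

namespace Admissible

variable (h : Admissible p σs σl δ G)
include h

lemma large_nonneg : 0 ≤ σl := h.small_nonneg.trans h.small_le_large

lemma log_pos : 0 < Real.log (3 / δ) :=
  one_pos.trans_le (one_le_log_three_div h.delta_pos h.delta_le_one)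

lemma tau_nonneg : 0 ≤ tauStar p σs σl δ :=
  tauStar_nonneg h.small_nonneg h.large_nonneg h.delta_pos h.delta_le_one

lemma threshold_nonneg (t : ℕ) : 0 ≤ threshold p σs σl δ G t :=
  le_max_of_le_left (by linarith [h.bound_nonneg])

lemma threshold_mono (htT : t ≤ T) : threshold p σs σl δ G t ≤ threshold p σs σl δ G T := by
  have h1 := h.tau_nonneg
  have h2 := h.one_lt
  unfold threshold
  gcongr

/-- T³ is the order of the total weight. After multiplication by it the rate is a sum of eight
nonnegative terms, so each of them is at most the whole; T³ / T^(2−2/p) becomes T · T^(2/p). -/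
lemma rate_parts (hμ : 0 < μ) (hT : 1 ≤ T) :
    μ * D ^ 2 ≤ T ^ 3 * rate p σs σl δ G μ D T ∧
    T * (phi p σs σl δ G T ^ 2 * G ^ 2) / μ ≤ T ^ 3 * rate p σs σl δ G μ D T ∧
    T * (Real.log (3 / δ) ^ 2 * G ^ 2) / μ ≤ T ^ 3 * rate p σs σl δ G μ D T ∧
    T ^ 2 * (σl ^ p * G ^ (2 - p)) / μ ≤ T ^ 3 * rate p σs σl δ G μ D T ∧
    T ^ 2 * (σs ^ p * Real.log (3 / δ) * G ^ (2 - p)) / μ ≤ T ^ 3 * rate p σs σl δ G μ D T ∧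
    T ^ 2 * G ^ 2 / μ ≤ T ^ 3 * rate p σs σl δ G μ D T ∧
    T * (T : ℝ) ^ (2 / p) * (σs ^ (4 / p - 2) * σl ^ (4 - 4 / p)) / μ ≤
      T ^ 3 * rate p σs σl δ G μ D T ∧
    T * (T : ℝ) ^ (2 / p) *
      (σs ^ (2 / p) * σl ^ (2 - 2 / p) * Real.log (3 / δ) ^ (2 - 2 / p)) / μ ≤
      T ^ 3 * rate p σs σl δ G μ D T := by
  have hs := h.small_nonneg
  have hl := h.large_nonneg
  have hL := h.log_pos
  have hG := h.bound_nonneg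
  have hT0 : (0 : ℝ) < T := by exact_mod_cast hT
  have e1 : T * (T : ℝ) ^ (2 / p) * (T : ℝ) ^ (2 - 2 / p) = T ^ 3 := by
    rw [mul_assoc, ← Real.rpow_add hT0]; norm_num; ring
  have e : T ^ 3 * rate p σs σl δ G μ D T = μ * D ^ 2
      + T * (phi p σs σl δ G T ^ 2 * G ^ 2) / μ + T * (Real.log (3 / δ) ^ 2 * G ^ 2) / μ
      + T ^ 2 * (σl ^ p * G ^ (2 - p)) / μ + T ^ 2 * (σs ^ p * Real.log (3 / δ) * G ^ (2 - p)) / μ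
      + T ^ 2 * G ^ 2 / μ + T * (T : ℝ) ^ (2 / p) * (σs ^ (4 / p - 2) * σl ^ (4 - 4 / p)) / μ
      + T * (T : ℝ) ^ (2 / p) *
        (σs ^ (2 / p) * σl ^ (2 - 2 / p) * Real.log (3 / δ) ^ (2 - 2 / p)) / μ := by
    have hTp : (T : ℝ) ^ (2 - 2 / p) ≠ 0 := (Real.rpow_pos_of_pos hT0 _).ne'
    have e2 : (T : ℝ) ^ 3 * ((σs ^ (4 / p - 2) * σl ^ (4 - 4 / p)
        + σs ^ (2 / p) * σl ^ (2 - 2 / p) * Real.log (3 / δ) ^ (2 - 2 / p))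
      / (μ * (T : ℝ) ^ (2 - 2 / p))) = T * (T : ℝ) ^ (2 / p) * (σs ^ (4 / p - 2) * σl ^ (4 - 4 / p)
        + σs ^ (2 / p) * σl ^ (2 - 2 / p) * Real.log (3 / δ) ^ (2 - 2 / p)) / μ := by
      rw [← e1, mul_div_assoc', div_eq_div_iff (by positivity) hμ.ne']
      ring
    unfold rate
    rw [mul_add, e2]
    generalize σs ^ (4 / p - 2) * σl ^ (4 - 4 / p) = S1
    generalize σs ^ (2 / p) * σl ^ (2 - 2 / p) * Real.log (3 / δ) ^ (2 - 2 / p) = S2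
    generalize (T : ℝ) ^ (2 / p) = Tq
    generalize G ^ (2 - p) = Gq
    generalize σl ^ p = a
    generalize σs ^ p = b
    field_simp
    ring
  have h1 : 0 ≤ μ * D ^ 2 := by positivity
  have h2 : 0 ≤ T * (phi p σs σl δ G T ^ 2 * G ^ 2) / μ := by positivity
  have h3 : 0 ≤ T * (Real.log (3 / δ) ^ 2 * G ^ 2) / μ := by positivity
  have h4 : 0 ≤ T ^ 2 * (σl ^ p * G ^ (2 - p)) / μ := by positivity
  have h5 : 0 ≤ T ^ 2 * (σs ^ p * Real.log (3 / δ) * G ^ (2 - p)) / μ := by positivity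
  have h6 : 0 ≤ T ^ 2 * G ^ 2 / μ := by positivity
  have h7 : 0 ≤ T * (T : ℝ) ^ (2 / p) * (σs ^ (4 / p - 2) * σl ^ (4 - 4 / p)) / μ := by positivity
  have h8 : 0 ≤ T * (T : ℝ) ^ (2 / p) *
      (σs ^ (2 / p) * σl ^ (2 - 2 / p) * Real.log (3 / δ) ^ (2 - 2 / p)) / μ := by positivity
  rw [e]
  refine ⟨?_, ?_, ?_, ?_, ?_, ?_, ?_, ?_⟩ <;> linarith

lemma threshold_rpow_le (t : ℕ) : threshold p σs σl δ G t ^ (2 - p) ≤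
    2 * G ^ (2 - p) + tauStar p σs σl δ ^ (2 - p) * (t : ℝ) ^ (2 / p - 1) := by
  have hτ := h.tau_nonneg
  have hG := h.bound_nonneg
  have hp := h.one_lt
  have e : (tauStar p σs σl δ * (t : ℝ) ^ (1 / p)) ^ (2 - p) =
      tauStar p σs σl δ ^ (2 - p) * (t : ℝ) ^ (2 / p - 1) := by
    rw [Real.mul_rpow hτ (by positivity), ← Real.rpow_mul (Nat.cast_nonneg t)]
    congr 2
    field_simp
  have h1 := two_mul_rpow_le hp hG
  have h2 : 0 ≤ tauStar p σs σl δ ^ (2 - p) * (t : ℝ) ^ (2 / p - 1) := by positivity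
  have h3 : 0 ≤ 2 * G ^ (2 - p) := by positivity
  unfold threshold
  rcases max_choice (2 * G) (tauStar p σs σl δ * (t : ℝ) ^ (1 / p)) with h | h <;> rw [h]
  · linarith
  · rw [e]; linarith

/-- It controls the almost sure size of the noise in both concentration inequalities. -/
lemma sq_threshold_bound (hμ : 0 < μ) (hT : 1 ≤ T) :
    Real.log (3 / δ) ^ 2 * T * threshold p σs σl δ G T ^ 2 / μ ≤
      5 * (T ^ 3 * rate p σs σl δ G μ D T) := by
  obtain ⟨-, -, h3, -, -, -, -, h8⟩ := h.rate_parts (D := D) hμ hT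
  have hB := sq_log_mul_sq_tauStar_le h.one_lt h.small_nonneg h.small_le_large h.large_eq_zero
    h.delta_pos h.delta_le_one
  have hT' := sq_threshold_le p σs σl δ G T
  set L := Real.log (3 / δ)
  set S2 := σs ^ (2 / p) * σl ^ (2 - 2 / p) * L ^ (2 - 2 / p)
  set Q := T ^ 3 * rate p σs σl δ G μ D T
  calc L ^ 2 * T * threshold p σs σl δ G T ^ 2 / μ
      ≤ L ^ 2 * T * (4 * G ^ 2 + tauStar p σs σl δ ^ 2 * (T : ℝ) ^ (2 / p)) / μ := by gcongr
    _ = 4 * (T * (L ^ 2 * G ^ 2) / μ) +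
        T * (T : ℝ) ^ (2 / p) * (L ^ 2 * tauStar p σs σl δ ^ 2) / μ := by ring
    _ ≤ 4 * (T * (L ^ 2 * G ^ 2) / μ) + T * (T : ℝ) ^ (2 / p) * S2 / μ := by gcongr
    _ ≤ 5 * Q := by linarith

/-- One factor T comes from weight times stepsize, the other from the number of summands of the
quadratic noise. -/
lemma variance_bound (hμ : 0 < μ) (hT : 1 ≤ T) :
    T ^ 2 * (threshold p σs σl δ G T ^ (2 - p) * σl ^ p) / μ ≤
      3 * (T ^ 3 * rate p σs σl δ G μ D T) := by
  obtain ⟨-, -, -, h4, -, -, h7, -⟩ := h.rate_parts (D := D) hμ hT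
  have hA := large_rpow_mul_tauStar_rpow_le h.one_lt h.le_two h.small_nonneg h.small_le_large
    h.large_eq_zero h.delta_pos h.delta_le_one
  have hT' := h.threshold_rpow_le T
  have hl := h.large_nonneg
  have hT0 : (0 : ℝ) < T := by exact_mod_cast hT
  have e : (T : ℝ) ^ 2 * (T : ℝ) ^ (2 / p - 1) = T * (T : ℝ) ^ (2 / p) := by
    rw [Real.rpow_sub_one hT0.ne']; field_simp
  set S1 := σs ^ (4 / p - 2) * σl ^ (4 - 4 / p)
  set Q := T ^ 3 * rate p σs σl δ G μ D T
  calc T ^ 2 * (threshold p σs σl δ G T ^ (2 - p) * σl ^ p) / μ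
      ≤ T ^ 2 * ((2 * G ^ (2 - p) + tauStar p σs σl δ ^ (2 - p) * (T : ℝ) ^ (2 / p - 1))
          * σl ^ p) / μ := by gcongr
    _ = 2 * (T ^ 2 * (σl ^ p * G ^ (2 - p)) / μ) +
        ((T : ℝ) ^ 2 * (T : ℝ) ^ (2 / p - 1)) * (σl ^ p * tauStar p σs σl δ ^ (2 - p)) / μ := by
        ring
    _ ≤ 2 * (T ^ 2 * (σl ^ p * G ^ (2 - p)) / μ) + T * (T : ℝ) ^ (2 / p) * S1 / μ := by
        rw [e]; gcongr
    _ ≤ 3 * Q := by linarith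

/-- It supplies the variance condition in Bernstein's inequality. The second part of the directional
variance is a mixed product of L G and φ G, split by the arithmetic-geometric mean inequality. -/
lemma directional_bound (hμ : 0 < μ) (ht : 1 ≤ t) (htT : t ≤ T) :
    Real.log (3 / δ) * t ^ 2 * directionalBound p σs σl δ G t / μ ≤
      20 * (T ^ 3 * rate p σs σl δ G μ D T) := by
  have hT := ht.trans htT
  obtain ⟨-, h2, h3, -, h5, -, -, h8⟩ := h.rate_parts (D := D) hμ hT
  have hC := log_mul_small_rpow_mul_tauStar_rpow_le h.one_lt h.le_two h.small_nonneg
    h.small_le_large h.delta_pos h.delta_le_one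
  have hQ := mul_large_rpow_mul_threshold_rpow_neg_le h.one_lt h.small_nonneg h.small_le_large
    h.large_eq_zero h.bound_nonneg h.delta_pos h.delta_le_one ht htT
  have hT' := h.threshold_rpow_le T
  have hs := h.small_nonneg
  have hG := h.bound_nonneg
  have hl := h.large_nonneg
  have hτ0 := h.threshold_nonneg t
  have hL := h.log_pos
  have hφ := phi_nonneg (p := p) (σs := σs) (σl := σl) h.delta_pos h.delta_le_one G T
  have hT0 : (0 : ℝ) < T := by exact_mod_cast hT
  have htT' : (t : ℝ) ≤ T := by exact_mod_cast htT
  have hmono : threshold p σs σl δ G t ^ (2 - p) ≤ threshold p σs σl δ G T ^ (2 - p) :=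
    Real.rpow_le_rpow (h.threshold_nonneg t) (h.threshold_mono htT) (by linarith [h.le_two])
  have e : (T : ℝ) ^ 2 * (T : ℝ) ^ (2 / p - 1) = T * (T : ℝ) ^ (2 / p) := by
    rw [Real.rpow_sub_one hT0.ne']; field_simp
  unfold directionalBound
  set L := Real.log (3 / δ)
  set S2 := σs ^ (2 / p) * σl ^ (2 - 2 / p) * L ^ (2 - 2 / p)
  set Q := T ^ 3 * rate p σs σl δ G μ D T
  set φ := phi p σs σl δ G T
  set τ := threshold p σs σl δ G t
  set τT := threshold p σs σl δ G T
  have a1 : L * t ^ 2 * (τ ^ (2 - p) * σs ^ p) / μ ≤ 3 * Q := by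
    calc L * t ^ 2 * (τ ^ (2 - p) * σs ^ p) / μ
        ≤ L * T ^ 2 * ((2 * G ^ (2 - p) + tauStar p σs σl δ ^ (2 - p) * (T : ℝ) ^ (2 / p - 1))
            * σs ^ p) / μ := by
          have := hmono.trans hT'
          gcongr
      _ = 2 * (T ^ 2 * (σs ^ p * L * G ^ (2 - p)) / μ) +
          ((T : ℝ) ^ 2 * (T : ℝ) ^ (2 / p - 1)) *
            (L * (σs ^ p * tauStar p σs σl δ ^ (2 - p))) / μ := by ring
      _ ≤ 2 * (T ^ 2 * (σs ^ p * L * G ^ (2 - p)) / μ) + T * (T : ℝ) ^ (2 / p) * S2 / μ := by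
          rw [e]; gcongr
      _ ≤ 3 * Q := by linarith
  have a2 : L * t ^ 2 * (G ^ 2 * (τ ^ (-p) * σl ^ p)) / μ ≤ Q := by
    calc L * t ^ 2 * (G ^ 2 * (τ ^ (-p) * σl ^ p)) / μ
        = L * t * G * (t * (G * (σl ^ p * τ ^ (-p)))) / μ := by ring
      _ ≤ L * T * G * (G * φ) / μ := by gcongr
      _ = T * ((L * G) * (φ * G)) / μ := by ring
      _ ≤ T * ((L ^ 2 * G ^ 2 + φ ^ 2 * G ^ 2) / 2) / μ := by
          gcongr
          nlinarith [sq_nonneg (L * G - φ * G)]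
      _ = (T * (φ ^ 2 * G ^ 2) / μ + T * (L ^ 2 * G ^ 2) / μ) / 2 := by ring
      _ ≤ Q := by linarith
  calc L * t ^ 2 * (4 * τ ^ (2 - p) * σs ^ p + 8 * G ^ 2 * τ ^ (-p) * σl ^ p) / μ
      = 4 * (L * t ^ 2 * (τ ^ (2 - p) * σs ^ p) / μ) +
        8 * (L * t ^ 2 * (G ^ 2 * (τ ^ (-p) * σl ^ p)) / μ) := by ring
    _ ≤ 20 * Q := by linarith

/-- The factor t² is the order of the weight, and T counts the summands. -/
lemma bias_bound (hμ : 0 < μ) (ht : 1 ≤ t) (htT : t ≤ T) :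
    T * (t ^ 2 * biasBound p σs σl δ G t ^ 2) / μ ≤
      132 * (T ^ 3 * rate p σs σl δ G μ D T) := by
  have hT := ht.trans htT
  obtain ⟨-, h2, -, -, -, -, h7, h8⟩ := h.rate_parts (D := D) hμ hT
  have hD := sq_bias_tauStar_le h.one_lt h.small_nonneg h.small_le_large h.delta_pos
    h.delta_le_one
  have hQ := mul_large_rpow_mul_threshold_rpow_neg_le h.one_lt h.small_nonneg h.small_le_large
    h.large_eq_zero h.bound_nonneg h.delta_pos h.delta_le_one ht htT
  have hs := h.small_nonneg
  have hl := h.large_nonneg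
  have hG := h.bound_nonneg
  have hp := h.one_lt
  have hL := h.log_pos
  have ht0 : (0 : ℝ) < t := by exact_mod_cast ht
  have htT' : (t : ℝ) ≤ T := by exact_mod_cast htT
  have hτ0 := h.threshold_nonneg t
  unfold biasBound
  set L := Real.log (3 / δ)
  set S1 := σs ^ (4 / p - 2) * σl ^ (4 - 4 / p) with hS1
  set S2 := σs ^ (2 / p) * σl ^ (2 - 2 / p) * L ^ (2 - 2 / p) with hS2
  set Q := T ^ 3 * rate p σs σl δ G μ D T
  set φ := phi p σs σl δ G T
  set τ := threshold p σs σl δ G t with hτ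
  have hS1' : 0 ≤ S1 := by positivity
  have hS2' : 0 ≤ S2 := by positivity
  have a1 : t ^ 2 * (σs * σl ^ (p - 1) * τ ^ (1 - p)) ^ 2 ≤ (T : ℝ) ^ (2 / p) * (S1 + S2) := by
    rcases hs.eq_or_lt with hs' | hs'
    · rw [← hs', zero_mul, zero_mul]
      norm_num
      positivity
    have hτs := (log_tauStar hp hs' (hs'.trans_le h.small_le_large) h.delta_pos h.delta_le_one).1
    have b1 : τ ^ (1 - p) ≤ (tauStar p σs σl δ * (t : ℝ) ^ (1 / p)) ^ (1 - p) :=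
      Real.rpow_le_rpow_of_nonpos (by positivity) (le_max_right _ _) (by linarith)
    have b2 : (tauStar p σs σl δ * (t : ℝ) ^ (1 / p)) ^ (1 - p) =
        tauStar p σs σl δ ^ (1 - p) * (t : ℝ) ^ (1 / p - 1) := by
      rw [Real.mul_rpow hτs.le (by positivity), ← Real.rpow_mul ht0.le]
      congr 2
      field_simp
    rw [b2] at b1
    have b3 : t ^ 2 * ((t : ℝ) ^ (1 / p - 1)) ^ 2 = (t : ℝ) ^ (2 / p) := by
      rw [Real.rpow_sub_one ht0.ne', div_pow, ← Real.rpow_natCast ((t : ℝ) ^ (1 / p)),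
        ← Real.rpow_mul ht0.le]
      have : 1 / p * ((2 : ℕ) : ℝ) = 2 / p := by push_cast; ring
      rw [this]
      field_simp
    calc t ^ 2 * (σs * σl ^ (p - 1) * τ ^ (1 - p)) ^ 2
        ≤ t ^ 2 * (σs * σl ^ (p - 1) *
            (tauStar p σs σl δ ^ (1 - p) * (t : ℝ) ^ (1 / p - 1))) ^ 2 := by gcongr
      _ = (t ^ 2 * ((t : ℝ) ^ (1 / p - 1)) ^ 2) *
          (σs * σl ^ (p - 1) * tauStar p σs σl δ ^ (1 - p)) ^ 2 := by ring
      _ = (t : ℝ) ^ (2 / p) * (σs * σl ^ (p - 1) * tauStar p σs σl δ ^ (1 - p)) ^ 2 := by rw [b3]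
      _ ≤ (T : ℝ) ^ (2 / p) * (S1 + S2) := by gcongr
  have a2 : t ^ 2 * (G * (σl ^ p * τ ^ (-p))) ^ 2 ≤ φ ^ 2 * G ^ 2 := by
    calc t ^ 2 * (G * (σl ^ p * τ ^ (-p))) ^ 2 = (t * (G * (σl ^ p * τ ^ (-p)))) ^ 2 := by ring
      _ ≤ (G * φ) ^ 2 := by gcongr
      _ = _ := by ring
  generalize σs * σl ^ (p - 1) * τ ^ (1 - p) = x at *
  generalize G * (σl ^ p * τ ^ (-p)) = y at *
  -- By (5x + 4y)² ≤ 50x² + 32y², the total constant is 50 + 50 + 32 = 132.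
  calc T * (t ^ 2 * (5 * x + 4 * y) ^ 2) / μ
      ≤ T * (50 * (t ^ 2 * x ^ 2) + 32 * (t ^ 2 * y ^ 2)) / μ := by
        gcongr
        have : 0 ≤ (t : ℝ) ^ 2 * (5 * x - 4 * y) ^ 2 := by positivity
        nlinarith
    _ ≤ T * (50 * ((T : ℝ) ^ (2 / p) * (S1 + S2)) + 32 * (φ ^ 2 * G ^ 2)) / μ := by gcongr
    _ = 50 * (T * (T : ℝ) ^ (2 / p) * S1 / μ) + 50 * (T * (T : ℝ) ^ (2 / p) * S2 / μ) +
        32 * (T * (φ ^ 2 * G ^ 2) / μ) := by ring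
    _ ≤ 132 * Q := by linarith

end Admissible

end Bounds

/-! ### The weighted recursion and the bootstrap argument. -/

section Deterministic

/-- The weight of the iterate `x (t + 1)`. -/
def weight (t : ℕ) : ℝ := ((t : ℝ) + 4) * ((t : ℝ) + 5)

lemma weight_pos (t : ℕ) : 0 < weight t := by unfold weight; positivity

lemma weight_le {t : ℕ} (ht : 1 ≤ t) : weight t ≤ 30 * (t : ℝ) ^ 2 := by
  have : (1 : ℝ) ≤ t := by exact_mod_cast ht
  unfold weight
  nlinarith

lemma cube_le_sum_weight (T : ℕ) : (T : ℝ) ^ 3 / 3 ≤ ∑ t ∈ Finset.Icc 1 T, weight t := by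
  induction T with
  | zero => simp
  | succ n ih =>
    rw [Finset.sum_Icc_succ_top (by omega)]
    have : (0 : ℝ) ≤ n := Nat.cast_nonneg n
    unfold weight at *
    push_cast
    nlinarith

variable {μ B RK Rv : ℝ} {T : ℕ} {Δ N U K v a : ℕ → ℝ}

/-- In units of μ/12, step t leaves (t+4)(t+5)(t+6) a_{t+1}, of which step t+1 consumes only
(t+1)(t+5)(t+6). The remaining 3(t+5)(t+6) is the surplus μ/4 times the next weight. At n = 0 the
coefficient is 4 · 5 · 6 / 12 = 10. -/
lemma weighted_telescope (h : ∀ t, 1 ≤ t → t ≤ T →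
      Δ t ≤ N t + μ * t / 12 * a t - (μ * t / 12 + μ / 2) * a (t + 1)) :
    ∀ n : ℕ, n ≤ T → ∑ t ∈ Finset.Icc 1 n, weight t * Δ t
        + μ / 12 * (((n : ℝ) + 4) * (n + 5) * (n + 6)) * a (n + 1)
        + μ / 4 * ∑ t ∈ Finset.Icc 1 n, weight t * a t ≤
      10 * μ * a 1 + ∑ t ∈ Finset.Icc 1 n, weight t * N t := by
  intro n
  induction n with
  | zero => intro _; norm_num; linarith
  | succ n ih =>
    intro hn
    have h1 := ih (by omega)
    have h2 := mul_le_mul_of_nonneg_left (h (n + 1) (by omega) hn) (weight_pos (n + 1)).le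
    rw [Finset.sum_Icc_succ_top (by omega), Finset.sum_Icc_succ_top (by omega),
      Finset.sum_Icc_succ_top (by omega)]
    have e : weight (n + 1) = ((n : ℝ) + 5) * (n + 6) := by unfold weight; push_cast; ring
    rw [e] at h2 ⊢
    push_cast at h2 ⊢
    linear_combination h1 + h2

open Classical in
/-- The indicator of the event that the squared distances `a s` have stayed small up to time
`t`. -/
noncomputable def stayedSmall (μ B : ℝ) (a : ℕ → ℝ) (t : ℕ) : ℝ :=
  if ∀ s : ℕ, 1 ≤ s → s ≤ t → μ * (s : ℝ) ^ 3 * a s ≤ 12 * B then 1 else 0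

lemma stayedSmall_cases (μ B : ℝ) (a : ℕ → ℝ) {t : ℕ} (ht : 1 ≤ t) :
    stayedSmall μ B a t = 0 ∨ stayedSmall μ B a t = 1 ∧ μ * (t : ℝ) ^ 3 * a t ≤ 12 * B := by
  unfold stayedSmall
  split_ifs with h
  · exact Or.inr ⟨rfl, h t ht le_rfl⟩
  · exact Or.inl rfl

/-- A recursive inequality whose noise is controlled only as long as the squared distances stay
small is controlled throughout. -/
lemma bootstrap (hμ : 0 < μ) (hΔ : ∀ t, 1 ≤ t → t ≤ T → 0 ≤ Δ t) (ha : ∀ t, 0 ≤ a t)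
    (hK : ∀ t, 0 ≤ K t) (hv : ∀ t, 0 ≤ v t)
    (hstep : ∀ t, 1 ≤ t → t ≤ T →
      Δ t ≤ (U t + μ / 16 * a t + K t + v t) + μ * t / 12 * a t
        - (μ * t / 12 + μ / 2) * a (t + 1))
    (hU : ∑ t ∈ Finset.Icc 1 T, (stayedSmall μ B a t * (weight t * U t)
      - stayedSmall μ B a t * (weight t * (μ / 16 * a t))) ≤ B / 2)
    (hKs : ∑ t ∈ Finset.Icc 1 T, weight t * K t ≤ RK)
    (hvs : ∑ t ∈ Finset.Icc 1 T, weight t * v t ≤ Rv)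
    (hB : 10 * μ * a 1 + RK + Rv ≤ B / 2) :
    ∑ t ∈ Finset.Icc 1 T, weight t * Δ t ≤ B ∧ μ * (T : ℝ) ^ 3 * a (T + 1) ≤ 12 * B := by
  have hmono : ∀ {c : ℕ → ℝ} {n : ℕ}, (∀ t, 0 ≤ c t) → n ≤ T →
      ∑ t ∈ Finset.Icc 1 n, weight t * c t ≤ ∑ t ∈ Finset.Icc 1 T, weight t * c t :=
    fun hc hn => Finset.sum_le_sum_of_subset_of_nonneg (Finset.Icc_subset_Icc_right hn)
      fun t _ _ => mul_nonneg (weight_pos t).le (hc t)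
  have core : ∀ n : ℕ, n ≤ T → (∀ s : ℕ, 1 ≤ s → s ≤ n → μ * (s : ℝ) ^ 3 * a s ≤ 12 * B) →
      (n = T ∨ ¬ μ * ((n + 1 : ℕ) : ℝ) ^ 3 * a (n + 1) ≤ 12 * B) →
      ∑ t ∈ Finset.Icc 1 n, weight t * Δ t
        + μ / 12 * (((n : ℝ) + 4) * (n + 5) * (n + 6)) * a (n + 1) ≤ B := by
    intro n hn hgood hbad
    have h1 := weighted_telescope hstep n hn
    have h2 : ∑ t ∈ Finset.Icc 1 n, (weight t * U t - weight t * (μ / 16 * a t)) ≤ B / 2 := by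
      -- The indicator is 1 up to n and, if n < T, 0 afterwards because of the violation at n + 1.
      -- So the full truncated sum is the untruncated sum up to n.
      refine le_trans (le_of_eq ?_) hU
      have hsub : Finset.Icc 1 n ⊆ Finset.Icc 1 T := Finset.Icc_subset_Icc_right hn
      rw [← Finset.sum_subset hsub]
      · refine Finset.sum_congr rfl fun t ht => ?_
        rw [Finset.mem_Icc] at ht
        have : stayedSmall μ B a t = 1 := if_pos fun s hs1 hs2 => hgood s hs1 (hs2.trans ht.2)
        rw [this, one_mul, one_mul]
      · intro t ht ht'
        rw [Finset.mem_Icc] at ht ht'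
        have hnt : n + 1 ≤ t := by by_contra hlt; exact ht' ⟨ht.1, by omega⟩
        have : stayedSmall μ B a t = 0 := by
          refine if_neg fun hall => ?_
          rcases hbad with rfl | hbad
          · omega
          · exact hbad (hall (n + 1) (by omega) hnt)
        rw [this, zero_mul, zero_mul, sub_zero]
    have h3 := (hmono hK hn).trans hKs
    have h4 := (hmono hv hn).trans hvs
    have h5 : 0 ≤ ∑ t ∈ Finset.Icc 1 n, weight t * a t :=
      Finset.sum_nonneg fun t _ => mul_nonneg (weight_pos t).le (ha t)
    -- The μ/16 from the descent step and the μ/16 of the compensator together use half of the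
    -- surplus.
    have h6 : ∑ t ∈ Finset.Icc 1 n, weight t * (U t + μ / 16 * a t + K t + v t) =
        ∑ t ∈ Finset.Icc 1 n, (weight t * U t - weight t * (μ / 16 * a t)) +
        μ / 8 * ∑ t ∈ Finset.Icc 1 n, weight t * a t + ∑ t ∈ Finset.Icc 1 n, weight t * K t +
        ∑ t ∈ Finset.Icc 1 n, weight t * v t := by
      rw [Finset.mul_sum, ← Finset.sum_add_distrib, ← Finset.sum_add_distrib,
        ← Finset.sum_add_distrib]
      exact Finset.sum_congr rfl fun t _ => by ring
    rw [h6] at h1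
    nlinarith
  have hnext : ∀ n : ℕ, n ≤ T → ∑ t ∈ Finset.Icc 1 n, weight t * Δ t
      + μ / 12 * (((n : ℝ) + 4) * (n + 5) * (n + 6)) * a (n + 1) ≤ B →
      μ * ((n : ℝ) + 1) ^ 3 * a (n + 1) ≤ 12 * B := by
    intro n hn h
    have h1 : 0 ≤ ∑ t ∈ Finset.Icc 1 n, weight t * Δ t :=
      Finset.sum_nonneg fun t ht => by
        rw [Finset.mem_Icc] at ht
        exact mul_nonneg (weight_pos t).le (hΔ t ht.1 (ht.2.trans hn))
    have hn0 : (0 : ℝ) ≤ n := Nat.cast_nonneg n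
    have h2 : ((n : ℝ) + 1) ^ 3 ≤ ((n : ℝ) + 4) * (n + 5) * (n + 6) := by nlinarith
    have h3 : μ * ((n : ℝ) + 1) ^ 3 * a (n + 1) ≤
        μ * (((n : ℝ) + 4) * (n + 5) * (n + 6)) * a (n + 1) := by
      have := ha (n + 1)
      gcongr
    linarith
  have hgood : ∀ n : ℕ, n ≤ T → ∀ s : ℕ, 1 ≤ s → s ≤ n → μ * (s : ℝ) ^ 3 * a s ≤ 12 * B := by
    intro n
    induction n with
    | zero => intro _ s h1 h2; omega
    | succ n ih =>
      intro hn s h1 h2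
      rcases Nat.lt_or_ge s (n + 1) with hs | hs
      · exact ih (by omega) s h1 (by omega)
      obtain rfl : s = n + 1 := by omega
      -- A first violation at n + 1 is refuted by the recursion up to n.
      by_contra hbad
      have := hnext n (by omega) (core n (by omega) (ih (by omega)) (Or.inr hbad))
      push_cast at hbad
      exact hbad this
  have hfin := core T le_rfl (hgood T le_rfl) (Or.inl rfl)
  have hT0 : (0 : ℝ) ≤ T := Nat.cast_nonneg T
  have h0 := ha (T + 1)
  constructor
  · have : 0 ≤ μ / 12 * (((T : ℝ) + 4) * (T + 5) * (T + 6)) * a (T + 1) := by positivity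
    linarith
  · refine le_trans ?_ (hnext T le_rfl hfin)
    gcongr
    linarith

end Deterministic

/-! ### The iterates as functions of the past samples. -/

section Measurability

variable {d : ℕ} {Ξ Ω : Type*} {X : Set (EuclideanSpace ℝ (Fin d))}
  {r : EuclideanSpace ℝ (Fin d) → ℝ} {g : EuclideanSpace ℝ (Fin d) → Ξ → EuclideanSpace ℝ (Fin d)}
  {μ : ℝ} {η τ : ℕ → ℝ} {x₁ : EuclideanSpace ℝ (Fin d)} {ξ : ℕ → Ω → Ξ} {T : ℕ}
  {x : ℕ → Ω → EuclideanSpace ℝ (Fin d)}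

lemma IsClippedSGDRun.mem (h : IsClippedSGDRun X r g η τ x₁ ξ T x) (hx₁ : x₁ ∈ X) {t : ℕ}
    (h1 : 1 ≤ t) (hT : t ≤ T + 1) (ω : Ω) : x t ω ∈ X := by
  rcases h1.eq_or_lt with rfl | h1
  · rw [(h ω).1]; exact hx₁
  · obtain ⟨n, rfl⟩ : ∃ n, t = n + 1 := ⟨t - 1, by omega⟩
    exact ((h ω).2 n (by omega) (by omega)).1

/-- The hypothesis says that u is a 1-Lipschitz function of q on the range of q, which extends to a
continuous map of the whole space. -/
lemma measurable_of_norm_sub_le {_ : MeasurableSpace Ω} {q u : Ω → EuclideanSpace ℝ (Fin d)}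
    (hq : Measurable q) (h : ∀ ω ω', ‖u ω - u ω'‖ ≤ ‖q ω - q ω'‖) : Measurable u := by
  have hfac : Function.FactorsThrough u q := fun ω ω' hω => by
    have := h ω ω'
    rw [hω, sub_self, norm_zero, norm_le_zero_iff, sub_eq_zero] at this
    exact this
  have hlip : LipschitzOnWith 1 (Function.extend q u 0) (Set.range q) := by
    refine LipschitzOnWith.of_dist_le_mul ?_
    rintro _ ⟨ω, rfl⟩ _ ⟨ω', rfl⟩
    rw [hfac.extend_apply, hfac.extend_apply, dist_eq_norm, dist_eq_norm]
    simpa using h ω ω'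
  obtain ⟨φ, hφ, heq⟩ := hlip.extend_finite_dimension
  have : u = φ ∘ q := funext fun ω => by
    rw [Function.comp_apply, ← heq ⟨ω, rfl⟩, hfac.extend_apply]
  rw [this]
  exact hφ.continuous.measurable.comp hq

variable [mΞ : MeasurableSpace Ξ]

/-- The iterates are given only as minimizers; nonexpansiveness of the proximal step makes each a
Lipschitz function of the previous iterate minus the scaled clipped gradient. -/
lemma IsClippedSGDRun.measurable (h : IsClippedSGDRun X r g η τ x₁ ξ T x) (hX : Convex ℝ X)
    (hμ : 0 ≤ μ) (hr : StronglyConvexFirstOrder X μ r) (hη : ∀ t, 1 ≤ t → 0 < η t)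
    (hg : Measurable fun q : EuclideanSpace ℝ (Fin d) × Ξ => g q.1 q.2) {t : ℕ}
    (h1 : 1 ≤ t) (hT : t ≤ T + 1) : Measurable[history ξ T t] (x t) := by
  induction t, h1 using Nat.le_induction with
  | base =>
    have : x 1 = fun _ => x₁ := funext fun ω => (h ω).1
    rw [this]
    exact measurable_const
  | succ n hn ih =>
    have hxn := (ih (by omega)).mono (history_mono ξ T (Nat.le_succ n)) le_rfl
    have hq : Measurable[history ξ T (n + 1)]
        (fun ω => x n ω - η n • clip (τ n) (g (x n ω) (ξ n ω))) :=
      hxn.sub (((measurable_clip (τ n)).comp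
        (hg.comp (hxn.prodMk (measurable_sample ξ hn (by omega))))).const_smul (η n))
    exact measurable_of_norm_sub_le hq fun ω ω' =>
      ((h ω).2 n hn (by omega)).norm_sub_le hX hμ hr (hη n hn) ((h ω').2 n hn (by omega))

lemma measurable_stayedSmall {x : ℕ → Ω → EuclideanSpace ℝ (Fin d)}
    (xs : EuclideanSpace ℝ (Fin d)) (μ B : ℝ) {t : ℕ}
    (h : ∀ s, 1 ≤ s → s ≤ t → Measurable[history ξ T s] (x s)) :
    Measurable[history ξ T t]
      (fun ω => stayedSmall μ B (fun s => ‖x s ω - xs‖ ^ 2) t) := by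
  unfold stayedSmall
  refine Measurable.ite ?_ measurable_const measurable_const
  simp only [Set.ofPred_forall]
  refine MeasurableSet.iInter fun s => MeasurableSet.iInter fun h1 => MeasurableSet.iInter
    fun h2 => ?_
  have hs := (h s h1 h2).mono (history_mono ξ T h2) le_rfl
  let := history ξ T t
  exact measurableSet_le (((hs.sub_const xs).norm.pow_const 2).const_mul _) measurable_const

/-- An oracle on `X` agrees there with a jointly measurable map. -/
lemma exists_measurable_extension (hX : IsClosed X)
    (hg : Measurable fun q : X × Ξ => g (q.1 : EuclideanSpace ℝ (Fin d)) q.2) :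
    ∃ g' : EuclideanSpace ℝ (Fin d) → Ξ → EuclideanSpace ℝ (Fin d),
      (Measurable fun q : EuclideanSpace ℝ (Fin d) × Ξ => g' q.1 q.2) ∧
        ∀ y ∈ X, g' y = g y := by
  have hemb : MeasurableEmbedding
      (Prod.map Subtype.val id : X × Ξ → EuclideanSpace ℝ (Fin d) × Ξ) :=
    (MeasurableEmbedding.subtype_coe hX.measurableSet).prodMap MeasurableEmbedding.id
  refine ⟨fun y z => Function.extend (Prod.map Subtype.val id)
    (fun q : X × Ξ => g (q.1 : EuclideanSpace ℝ (Fin d)) q.2) 0 (y, z),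
    hemb.measurable_extend hg measurable_const, fun y hy => funext fun z => ?_⟩
  exact hemb.injective.extend_apply _ _ (⟨y, hy⟩, z)

end Measurability

/-! ### From `[0, ∞]`-valued to real moment bounds. -/

section Oracle

variable {d : ℕ} {Ξ : Type*} [MeasurableSpace Ξ] {𝒟 : Measure Ξ}
  {X : Set (EuclideanSpace ℝ (Fin d))}
  {gradf : EuclideanSpace ℝ (Fin d) → EuclideanSpace ℝ (Fin d)}
  {g : EuclideanSpace ℝ (Fin d) → Ξ → EuclideanSpace ℝ (Fin d)} {p σs σl : ℝ}

lemma integrable_and_integral_le_of_lintegral_le {φ : Ξ → ℝ} {c : ℝ}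
    (hφ : AEStronglyMeasurable φ 𝒟) (h0 : ∀ z, 0 ≤ φ z) (hc : 0 ≤ c)
    (h : ∫⁻ z, ENNReal.ofReal (φ z) ∂𝒟 ≤ ENNReal.ofReal c) :
    Integrable φ 𝒟 ∧ ∫ z, φ z ∂𝒟 ≤ c := by
  refine ⟨⟨hφ, ?_⟩, ?_⟩
  · rw [hasFiniteIntegral_iff_ofReal (ae_of_all _ h0)]
    exact h.trans_lt ENNReal.ofReal_lt_top
  · rw [integral_eq_lintegral_of_nonneg_ae (ae_of_all _ h0) hφ]
    exact ENNReal.toReal_le_of_le_ofReal hc h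

lemma HeavyTailedOracle.momentBounds (h : HeavyTailedOracle X gradf g 𝒟 p σs σl)
    {y : EuclideanSpace ℝ (Fin d)} (hy : y ∈ X) :
    MomentBounds 𝒟 (g y) (gradf y) p σs σl := by
  have hs := h.zero_le_small
  have hl := hs.trans h.small_le_large
  have hm : AEMeasurable (fun z => g y z - gradf y) 𝒟 :=
    (h.integrable y hy).1.aemeasurable.sub_const _
  have hdir : ∀ e : EuclideanSpace ℝ (Fin d), ‖e‖ = 1 →
      Integrable (fun z => |⟪e, g y z - gradf y⟫| ^ p) 𝒟 ∧
        ∫ z, |⟪e, g y z - gradf y⟫| ^ p ∂𝒟 ≤ σs ^ p := fun e he =>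
    integrable_and_integral_le_of_lintegral_le
      ((AEMeasurable.const_inner hm (c := e)).abs.pow_const p).aestronglyMeasurable
      (fun z => by positivity) (by positivity) (h.directional_moment y hy e he)
  have hnorm := integrable_and_integral_le_of_lintegral_le
      (hm.norm.pow_const p).aestronglyMeasurable (fun z => by positivity) (by positivity)
      (h.norm_moment y hy)
  exact ⟨h.integrable y hy, h.unbiased y hy, fun e he => (hdir e he).1, fun e he => (hdir e he).2,
    hnorm.1, hnorm.2⟩

end Oracle

/-! ### The two noise events and the high-probability bound. -/

section Main

variable {d : ℕ} {Ξ Ω : Type*} [MeasurableSpace Ξ] [MeasurableSpace Ω] {𝒟 : Measure Ξ}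
  [IsProbabilityMeasure 𝒟] {P : Measure Ω} [IsProbabilityMeasure P]
  {X : Set (EuclideanSpace ℝ (Fin d))} {f r : EuclideanSpace ℝ (Fin d) → ℝ}
  {gradf : EuclideanSpace ℝ (Fin d) → EuclideanSpace ℝ (Fin d)}
  {g : EuclideanSpace ℝ (Fin d) → Ξ → EuclideanSpace ℝ (Fin d)}
  {xs x₁ : EuclideanSpace ℝ (Fin d)} {μ G p σs σl δ D B : ℝ} {T : ℕ} {ξ : ℕ → Ω → Ξ}
  {x : ℕ → Ω → EuclideanSpace ℝ (Fin d)}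

/-- The centered clipped gradient estimate at `y` for the sample `z`. -/
noncomputable def noise (𝒟 : Measure Ξ)
    (g : EuclideanSpace ℝ (Fin d) → Ξ → EuclideanSpace ℝ (Fin d)) (τ : ℝ)
    (y : EuclideanSpace ℝ (Fin d)) (z : Ξ) : EuclideanSpace ℝ (Fin d) :=
  clip τ (g y z) - ∫ z, clip τ (g y z) ∂𝒟

omit [IsProbabilityMeasure 𝒟] in
lemma measurable_noise [SFinite 𝒟]
    (hg : Measurable fun q : EuclideanSpace ℝ (Fin d) × Ξ => g q.1 q.2) (τ : ℝ) :
    Measurable fun q : EuclideanSpace ℝ (Fin d) × Ξ => noise 𝒟 g τ q.1 q.2 := by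
  have h1 : Measurable fun q : EuclideanSpace ℝ (Fin d) × Ξ => clip τ (g q.1 q.2) :=
    (measurable_clip τ).comp hg
  have h2 : Measurable fun y => ∫ z, clip τ (g y z) ∂𝒟 :=
    (h1.stronglyMeasurable.integral_prod_right' (ν := 𝒟)).measurable
  exact h1.sub (h2.comp measurable_fst)

lemma eta_le {t : ℕ} (hμ : 0 < μ) (ht : 1 ≤ t) : 6 / (μ * t) ≤ 6 / μ := by
  have : (1 : ℝ) ≤ t := by exact_mod_cast ht
  gcongr
  nlinarith

lemma weight_mul_eta_le {t : ℕ} (hμ : 0 < μ) (ht : 1 ≤ t) (htT : t ≤ T) :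
    weight t * (6 / (μ * t)) ≤ 180 * T / μ := by
  have h0 : (0 : ℝ) < t := by exact_mod_cast ht
  have hT : (t : ℝ) ≤ T := by exact_mod_cast htT
  calc weight t * (6 / (μ * t)) ≤ 30 * (t : ℝ) ^ 2 * (6 / (μ * t)) := by
        gcongr; exact weight_le ht
    _ = 180 * t / μ := by field_simp; ring
    _ ≤ 180 * T / μ := by gcongr

/-- The linear noise term satisfies, with high probability, the bound used in `bootstrap`. -/
lemma Admissible.measure_linear_noise_le (h : Admissible p σs σl δ G) (hμ : 0 < μ) (hT : 1 ≤ T)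
    (hg : Measurable fun q : EuclideanSpace ℝ (Fin d) × Ξ => g q.1 q.2)
    (hM : ∀ y ∈ X, MomentBounds 𝒟 (g y) (gradf y) p σs σl) (hG : ∀ y ∈ X, ‖gradf y‖ ≤ G)
    (hξ : ∀ t, 1 ≤ t → t ≤ T → Measurable (ξ t) ∧ P.map (ξ t) = 𝒟)
    (hind : iIndepFun (fun t : Set.Icc 1 T => ξ t) P)
    (hx : ∀ t, 1 ≤ t → t ≤ T → Measurable[history ξ T t] (x t))
    (hxX : ∀ t, 1 ≤ t → t ≤ T → ∀ ω, x t ω ∈ X)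
    (hB : B = 10 ^ 6 * (T ^ 3 * rate p σs σl δ G μ D T)) :
    P {ω | B / 2 < ∑ t ∈ Finset.Icc 1 T,
      (stayedSmall μ B (fun s => ‖x s ω - xs‖ ^ 2) t *
          (weight t * -⟪noise 𝒟 g (threshold p σs σl δ G t) (x t ω) (ξ t ω), x t ω - xs⟫)
        - stayedSmall μ B (fun s => ‖x s ω - xs‖ ^ 2) t *
          (weight t * (μ / 16 * ‖x t ω - xs‖ ^ 2)))} ≤
      ENNReal.ofReal (Real.exp (-Real.log (3 / δ))) := by
  have hL := h.log_pos
  have hL1 := one_le_log_three_div h.delta_pos h.delta_le_one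
  set L := Real.log (3 / δ) with hLdef
  have hB0 : 0 ≤ B := by
    have := (h.rate_parts (D := D) hμ hT).1
    have h1 : 0 ≤ μ * D ^ 2 := by positivity
    rw [hB]; linarith
  -- Bernstein's inequality is used with increment bound Λ = B/(2L), so that Λ L is the B/2 allowed
  -- by `bootstrap`.
  have e : B / (2 * L) * L = B / 2 := by field_simp
  rw [← e]
  refine measure_sum_sub_gt_le (S := EuclideanSpace ℝ (Fin d) × ℝ) hξ hind
    (s := fun t ω => (x t ω, stayedSmall μ B (fun s => ‖x s ω - xs‖ ^ 2) t))
    (fun t h1 h2 => (hx t h1 h2).prodMk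
      (measurable_stayedSmall xs μ B fun s hs1 hs2 => hx s hs1 (hs2.trans h2)))
    (W := fun t a z => a.2 *
      (weight t * -⟪noise 𝒟 g (threshold p σs σl δ G t) a.1 z, a.1 - xs⟫))
    (fun t => ?_) (q := fun t a => a.2 * (weight t * (μ / 16 * ‖a.1 - xs‖ ^ 2)))
    (fun t => ?_) (by positivity) L ?_ ?_ ?_ ?_
  · have h1 := (measurable_noise (𝒟 := 𝒟) hg (threshold p σs σl δ G t)).comp
      ((measurable_fst.comp measurable_fst).prodMk measurable_snd :
        Measurable fun q : (EuclideanSpace ℝ (Fin d) × ℝ) × Ξ => (q.1.1, q.2))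
    have h2 : Measurable fun q : (EuclideanSpace ℝ (Fin d) × ℝ) × Ξ => q.1.1 - xs :=
      (measurable_fst.comp measurable_fst).sub_const xs
    exact (measurable_snd.comp measurable_fst).mul ((Measurable.inner h1 h2).neg.const_mul _)
  · exact measurable_snd.mul
      ((((measurable_fst.sub_const xs).norm.pow_const 2).const_mul _).const_mul _)
  · intro t h1 h2 ω
    have hw := weight_pos t
    rcases stayedSmall_cases μ B (fun s => ‖x s ω - xs‖ ^ 2) h1 with hi | ⟨hi, -⟩
    · simp only [hi, zero_mul]; exact le_rfl
    · simp only [hi, one_mul]; positivity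
  · intro t h1 h2 ω z
    have hw := weight_pos t
    rcases stayedSmall_cases μ B (fun s => ‖x s ω - xs‖ ^ 2) h1 with hi | ⟨hi, hsm⟩
    · simp only [hi, zero_mul, abs_zero]; positivity
    simp only [hi, one_mul]
    have ht0 : (0 : ℝ) < t := by exact_mod_cast h1
    have htT : (t : ℝ) ≤ T := by exact_mod_cast h2
    have hτ0 := h.threshold_nonneg t
    have hτT := h.threshold_mono h2
    have hn : ‖noise 𝒟 g (threshold p σs σl δ G t) (x t ω) z‖ ≤ 2 * threshold p σs σl δ G t :=
      norm_clip_sub_integral_le hτ0 _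
    set τ := threshold p σs σl δ G t
    have hsq := h.sq_threshold_bound (D := D) hμ hT
    rw [← hLdef] at hsq
    rw [abs_mul, abs_neg, abs_of_pos hw]
    have hle : weight t * |⟪noise 𝒟 g τ (x t ω) z, x t ω - xs⟫| ≤
        30 * (t : ℝ) ^ 2 * (2 * τ * ‖x t ω - xs‖) := by
      refine mul_le_mul (weight_le h1) ((abs_real_inner_le_norm _ _).trans ?_) (abs_nonneg _)
        (by positivity)
      gcongr
    refine hle.trans (abs_le_of_sq_le_sq' ?_ (by positivity)).2
    have hsm' : (t : ℝ) ^ 3 * ‖x t ω - xs‖ ^ 2 ≤ 12 * B / μ := by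
      rw [le_div_iff₀ hμ]; linarith
    -- Here 172800 = 4 · 3600 · 12, and `sq_threshold_bound` adds a factor 5. The product 864000 is
    -- what fixes 10⁶ in the definition of B.
    have hB' : 172800 * (L ^ 2 * T * threshold p σs σl δ G T ^ 2 / μ) ≤ B := by
      rw [hB]
      have : 0 ≤ T ^ 3 * rate p σs σl δ G μ D T := by linarith
      linarith
    calc (30 * (t : ℝ) ^ 2 * (2 * τ * ‖x t ω - xs‖)) ^ 2
        = 3600 * (t * τ ^ 2) * ((t : ℝ) ^ 3 * ‖x t ω - xs‖ ^ 2) := by ring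
      _ ≤ 3600 * (T * threshold p σs σl δ G T ^ 2) * (12 * B / μ) := by gcongr
      _ = 172800 * (L ^ 2 * T * threshold p σs σl δ G T ^ 2 / μ) * B / (4 * L ^ 2) := by
          field_simp; ring
      _ ≤ B * B / (4 * L ^ 2) := by gcongr
      _ = (B / (2 * L)) ^ 2 := by field_simp; ring
  · intro t h1 h2 ω
    have hτ0 := h.threshold_nonneg t
    have hI := integrable_clip hτ0 (hM _ (hxX t h1 h2 ω)).integrable.1
    have hz : ∫ z, ⟪noise 𝒟 g (threshold p σs σl δ G t) (x t ω) z, x t ω - xs⟫ ∂𝒟 = 0 := by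
      simp_rw [real_inner_comm (x t ω - xs)]
      rw [integral_inner (f := fun z => noise 𝒟 g (threshold p σs σl δ G t) (x t ω) z)
        (hI.sub (integrable_const _))]
      unfold noise
      rw [integral_sub hI (integrable_const _)]
      simp
    simp only
    rw [integral_const_mul, integral_const_mul, integral_neg, hz]
    simp
  · intro t h1 h2 ω
    have hw := weight_pos t
    have hy := hxX t h1 h2 ω
    rcases stayedSmall_cases μ B (fun s => ‖x s ω - xs‖ ^ 2) h1 with hi | ⟨hi, -⟩
    · simp [hi]
    simp only [hi, one_mul]
    have hvar := (hM _ hy).integral_inner_clip_sub_sq_le h.one_lt h.le_two h.small_nonneg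
      h.large_nonneg (hG _ hy) (le_max_left (2 * G) (tauStar p σs σl δ * (t : ℝ) ^ (1 / p)))
      (x t ω - xs)
    have hdir := h.directional_bound (D := D) hμ h1 h2
    rw [← hLdef] at hdir
    -- This is the condition variance ≤ Λ q with the common factor, weight times squared distance,
    -- removed; numerically 30 · 20 ≤ 10⁶/32.
    have hV : weight t * directionalBound p σs σl δ G t ≤ B / (2 * L) * (μ / 16) := by
      have hV0 : 0 ≤ directionalBound p σs σl δ G t := by
        have := h.threshold_nonneg t
        have := h.small_nonneg
        have := h.large_nonneg
        unfold directionalBound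
        positivity
      calc weight t * directionalBound p σs σl δ G t
          ≤ 30 * (t : ℝ) ^ 2 * directionalBound p σs σl δ G t := by gcongr; exact weight_le h1
        _ = 30 * (L * t ^ 2 * directionalBound p σs σl δ G t / μ) * (μ / L) := by field_simp
        _ ≤ (B / 32) * (μ / L) := by
            gcongr
            rw [hB]
            have := (h.rate_parts (D := D) hμ hT).1
            have h1 : 0 ≤ μ * D ^ 2 := by positivity
            linarith
        _ = B / (2 * L) * (μ / 16) := by field_simp; ring
    have e : ∀ z, (weight t * -⟪noise 𝒟 g (threshold p σs σl δ G t) (x t ω) z, x t ω - xs⟫) ^ 2 =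
        weight t ^ 2 * ⟪x t ω - xs, noise 𝒟 g (threshold p σs σl δ G t) (x t ω) z⟫ ^ 2 := by
      intro z; rw [real_inner_comm]; ring
    simp_rw [e]
    rw [integral_const_mul]
    calc weight t ^ 2 * ∫ z, ⟪x t ω - xs, noise 𝒟 g (threshold p σs σl δ G t) (x t ω) z⟫ ^ 2 ∂𝒟
        ≤ weight t ^ 2 * (‖x t ω - xs‖ ^ 2 * directionalBound p σs σl δ G t) :=
          mul_le_mul_of_nonneg_left hvar (by positivity)
      _ = weight t * ‖x t ω - xs‖ ^ 2 * (weight t * directionalBound p σs σl δ G t) := by ring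
      _ ≤ weight t * ‖x t ω - xs‖ ^ 2 * (B / (2 * L) * (μ / 16)) := by gcongr
      _ = _ := by ring

/-- The quadratic noise term is, with high probability, at most of the order of the rate. -/
lemma Admissible.measure_quadratic_noise_le (h : Admissible p σs σl δ G) (hμ : 0 < μ)
    (hT : 1 ≤ T) (hg : Measurable fun q : EuclideanSpace ℝ (Fin d) × Ξ => g q.1 q.2)
    (hM : ∀ y ∈ X, MomentBounds 𝒟 (g y) (gradf y) p σs σl) (hG : ∀ y ∈ X, ‖gradf y‖ ≤ G)
    (hξ : ∀ t, 1 ≤ t → t ≤ T → Measurable (ξ t) ∧ P.map (ξ t) = 𝒟)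
    (hind : iIndepFun (fun t : Set.Icc 1 T => ξ t) P)
    (hx : ∀ t, 1 ≤ t → t ≤ T → Measurable[history ξ T t] (x t))
    (hxX : ∀ t, 1 ≤ t → t ≤ T → ∀ ω, x t ω ∈ X) (D : ℝ) :
    P {ω | 20160 * (T ^ 3 * rate p σs σl δ G μ D T) < ∑ t ∈ Finset.Icc 1 T,
      weight t * (2 * (6 / (μ * t)) *
        ‖noise 𝒟 g (threshold p σs σl δ G t) (x t ω) (ξ t ω)‖ ^ 2)} ≤
      ENNReal.ofReal (Real.exp (-Real.log (3 / δ))) := by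
  have hL := h.log_pos
  have hL1 := one_le_log_three_div h.delta_pos h.delta_le_one
  have hl := h.large_nonneg
  have hvarT := h.variance_bound (D := D) hμ hT
  have hsq := h.sq_threshold_bound (D := D) hμ hT
  have hτT0 := h.threshold_nonneg T
  set L := Real.log (3 / δ) with hLdef
  set τT := threshold p σs σl δ G T with hτT
  set m := 360 * T / μ * (6 * τT ^ (2 - p) * σl ^ p) with hm
  have hw : ∀ t, 1 ≤ t → t ≤ T → weight t * (2 * (6 / (μ * t))) ≤ 360 * T / μ := by
    intro t h1 h2
    have := weight_mul_eta_le (T := T) hμ h1 h2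
    calc weight t * (2 * (6 / (μ * t))) = 2 * (weight t * (6 / (μ * t))) := by ring
      _ ≤ 2 * (180 * T / μ) := by gcongr
      _ = 360 * T / μ := by ring
  have hw0 : ∀ t : ℕ, 0 ≤ weight t * (2 * (6 / (μ * t))) := fun t => by
    have := weight_pos t
    positivity
  have hm0 : 0 ≤ m := by positivity
  have key := measure_sum_nonneg_gt_le (S := EuclideanSpace ℝ (Fin d)) hξ hind (s := x) hx
    (V := fun t a z => weight t * (2 * (6 / (μ * t))) *
      ‖noise 𝒟 g (threshold p σs σl δ G t) a z‖ ^ 2)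
    (fun t => ((measurable_noise hg _).norm.pow_const 2).const_mul _) (m := fun _ => m)
    (Λ := 360 * T / μ * (2 * τT) ^ 2) (by positivity) L (fun _ _ _ => hm0)
    (fun t _ _ ω z => mul_nonneg (hw0 t) (by positivity))
    (fun t h1 h2 ω z => by
      have hn : ‖noise 𝒟 g (threshold p σs σl δ G t) (x t ω) z‖ ≤ 2 * τT :=
        (norm_clip_sub_integral_le (h.threshold_nonneg t) _).trans
          (by linarith [h.threshold_mono h2])
      have := hw t h1 h2
      gcongr)
    (fun t h1 h2 ω => by
      have hy := hxX t h1 h2 ω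
      have hvar := (hM _ hy).integral_norm_clip_sub_sq_le h.one_lt h.le_two h.large_nonneg
        (hG _ hy) (le_max_left (2 * G) (tauStar p σs σl δ * (t : ℝ) ^ (1 / p)))
      have hmono : threshold p σs σl δ G t ^ (2 - p) ≤ τT ^ (2 - p) :=
        Real.rpow_le_rpow (h.threshold_nonneg t) (h.threshold_mono h2) (by linarith [h.le_two])
      rw [integral_const_mul]
      refine mul_le_mul (hw t h1 h2) (hvar.trans ?_) (integral_nonneg fun z => by positivity)
        (by positivity)
      exact mul_le_mul_of_nonneg_right (mul_le_mul_of_nonneg_left hmono (by norm_num))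
        (by positivity))
  refine (measure_mono fun ω hω => ?_).trans key
  simp only [Set.mem_ofPred_eq] at hω ⊢
  rw [Finset.sum_sub_distrib, Finset.sum_const, Nat.card_Icc, nsmul_eq_mul]
  simp_rw [← mul_assoc] at hω
  simp_rw [← mul_assoc]
  -- The mean part costs 4320 · 3 and the deviation part 1440 · 5, in total 20160; L ≤ L² holds as L
  -- ≥ 1.
  have e1 : ((T + 1 - 1 : ℕ) : ℝ) * 2 * m =
      4320 * (T ^ 2 * (τT ^ (2 - p) * σl ^ p) / μ) := by
    rw [hm, Nat.add_sub_cancel]; ring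
  have e2 : 360 * T / μ * (2 * τT) ^ 2 * L ≤ 1440 * (L ^ 2 * T * τT ^ 2 / μ) := by
    calc 360 * T / μ * (2 * τT) ^ 2 * L = 1440 * (L * 1 * T * τT ^ 2 / μ) := by ring
      _ ≤ 1440 * (L * L * T * τT ^ 2 / μ) := by gcongr
      _ = _ := by ring
  rw [e1]
  linarith

/-- The high-probability bounds on the iterates for a jointly measurable oracle. -/
lemma Admissible.measure_good_ge (h : Admissible p σs σl δ G) (hμ : 0 < μ) (hT : 1 ≤ T)
    (hX : Convex ℝ X) (hxs : xs ∈ X) (hmin : IsMinOn (fun y => f y + r y) X xs)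
    (hr : StronglyConvexFirstOrder X μ r)
    (hf : ∀ y ∈ X, gradf y ∈ subdifferential f y) (hG : ∀ y ∈ X, ‖gradf y‖ ≤ G)
    (hg : Measurable fun q : EuclideanSpace ℝ (Fin d) × Ξ => g q.1 q.2)
    (hM : ∀ y ∈ X, MomentBounds 𝒟 (g y) (gradf y) p σs σl)
    (hξ : ∀ t, 1 ≤ t → t ≤ T → Measurable (ξ t) ∧ P.map (ξ t) = 𝒟)
    (hind : iIndepFun (fun t : Set.Icc 1 T => ξ t) P) (hx₁ : x₁ ∈ X)
    (hrun : IsClippedSGDRun X r g (fun t => 6 / (μ * t)) (threshold p σs σl δ G) x₁ ξ T x)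
    (hB : B = 10 ^ 6 * (T ^ 3 * rate p σs σl δ G μ ‖xs - x₁‖ T)) :
    ENNReal.ofReal (1 - δ) ≤ P {ω |
      ∑ t ∈ Finset.Icc 1 T,
        weight t * ((f (x (t + 1) ω) + r (x (t + 1) ω)) - (f xs + r xs)) ≤ B ∧
      μ * (T : ℝ) ^ 3 * ‖x (T + 1) ω - xs‖ ^ 2 ≤ 12 * B} := by
  have hη : ∀ t : ℕ, 1 ≤ t → 0 < 6 / (μ * (t : ℝ)) := fun t ht => by
    have : (0 : ℝ) < t := by exact_mod_cast ht
    positivity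
  have hxX : ∀ t, 1 ≤ t → t ≤ T + 1 → ∀ ω, x t ω ∈ X := fun t h1 h2 => hrun.mem hx₁ h1 h2
  have hx : ∀ t, 1 ≤ t → t ≤ T → Measurable[history ξ T t] (x t) := fun t h1 h2 =>
    hrun.measurable hX hμ.le hr hη hg h1 (by omega)
  have hxX' : ∀ t, 1 ≤ t → t ≤ T → ∀ ω, x t ω ∈ X := fun t h1 h2 => hxX t h1 (by omega)
  have hlin := h.measure_linear_noise_le (xs := xs) hμ hT hg hM hG hξ hind hx hxX' hB
  have hquad := h.measure_quadratic_noise_le hμ hT hg hM hG hξ hind hx hxX' ‖xs - x₁‖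
  set Q := T ^ 3 * rate p σs σl δ G μ ‖xs - x₁‖ T with hQ
  set A₁ := {ω | B / 2 < ∑ t ∈ Finset.Icc 1 T,
      (stayedSmall μ B (fun s => ‖x s ω - xs‖ ^ 2) t *
          (weight t * -⟪noise 𝒟 g (threshold p σs σl δ G t) (x t ω) (ξ t ω), x t ω - xs⟫)
        - stayedSmall μ B (fun s => ‖x s ω - xs‖ ^ 2) t *
          (weight t * (μ / 16 * ‖x t ω - xs‖ ^ 2)))} with hA₁
  set A₂ := {ω | 20160 * Q < ∑ t ∈ Finset.Icc 1 T,
      weight t * (2 * (6 / (μ * t)) *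
        ‖noise 𝒟 g (threshold p σs σl δ G t) (x t ω) (ξ t ω)‖ ^ 2)} with hA₂
  set A := {ω | ∑ t ∈ Finset.Icc 1 T,
        weight t * ((f (x (t + 1) ω) + r (x (t + 1) ω)) - (f xs + r xs)) ≤ B ∧
      μ * (T : ℝ) ^ 3 * ‖x (T + 1) ω - xs‖ ^ 2 ≤ 12 * B} with hA
  -- Outside the two bad events the argument is deterministic. Only subadditivity of P is used, so
  -- measurability of these sets plays no role.
  have hcover : Set.univ ⊆ A ∪ (A₁ ∪ A₂) := by
    intro ω _
    by_contra hω
    simp only [Set.mem_union, not_or] at hω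
    obtain ⟨hωA, hω₁, hω₂⟩ := hω
    rw [hA₁, Set.mem_ofPred_eq, not_lt] at hω₁
    rw [hA₂, Set.mem_ofPred_eq, not_lt] at hω₂
    refine hωA ?_
    have hparts := h.rate_parts (D := ‖xs - x₁‖) hμ hT
    obtain ⟨q1, -, -, -, -, q6, -, -⟩ := hparts
    have hT0 : (0 : ℝ) < T := by exact_mod_cast hT
    have hK : ∑ t ∈ Finset.Icc 1 T, weight t *
        (16 / μ * biasBound p σs σl δ G t ^ 2 + 4 * (6 / (μ * t)) * G ^ 2) ≤ 64080 * Q := by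
      have hterm : ∀ t ∈ Finset.Icc 1 T, weight t *
          (16 / μ * biasBound p σs σl δ G t ^ 2 + 4 * (6 / (μ * t)) * G ^ 2) ≤
          64080 * Q / T := by
        intro t ht
        rw [Finset.mem_Icc] at ht
        have hb := h.bias_bound (D := ‖xs - x₁‖) hμ ht.1 ht.2
        rw [le_div_iff₀ hT0]
        calc weight t * (16 / μ * biasBound p σs σl δ G t ^ 2 + 4 * (6 / (μ * t)) * G ^ 2) * T
            = weight t * (16 / μ * biasBound p σs σl δ G t ^ 2) * T +
              weight t * (6 / (μ * t)) * (4 * G ^ 2 * T) := by ring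
          _ ≤ 30 * (t : ℝ) ^ 2 * (16 / μ * biasBound p σs σl δ G t ^ 2) * T +
              180 * T / μ * (4 * G ^ 2 * T) := by
              have h1 := weight_le ht.1
              have h2 := weight_mul_eta_le (T := T) hμ ht.1 ht.2
              gcongr
          _ = 480 * (T * (t ^ 2 * biasBound p σs σl δ G t ^ 2) / μ) +
              720 * (T ^ 2 * G ^ 2 / μ) := by ring
          _ ≤ 64080 * Q := by linarith
      refine (Finset.sum_le_card_nsmul _ _ _ hterm).trans_eq ?_
      rw [Nat.card_Icc, nsmul_eq_mul, Nat.add_sub_cancel]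
      field_simp
    refine bootstrap (T := T) (B := B)
      (Δ := fun t => (f (x (t + 1) ω) + r (x (t + 1) ω)) - (f xs + r xs))
      (a := fun t => ‖x t ω - xs‖ ^ 2)
      (U := fun t => -⟪noise 𝒟 g (threshold p σs σl δ G t) (x t ω) (ξ t ω), x t ω - xs⟫)
      (K := fun t => 16 / μ * biasBound p σs σl δ G t ^ 2 + 4 * (6 / (μ * t)) * G ^ 2)
      (v := fun t => 2 * (6 / (μ * t)) *
        ‖noise 𝒟 g (threshold p σs σl δ G t) (x t ω) (ξ t ω)‖ ^ 2)
      hμ (fun t h1 h2 => sub_nonneg.2 (hmin (hxX (t + 1) (by omega) (by omega) ω)))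
      (fun t => by positivity) (fun t => by positivity) (fun t => by positivity)
      (fun t h1 h2 => ?_) hω₁ hK hω₂ ?_
    · have hy := hxX' t h1 h2 ω
      have hstep := (hrun ω).2 t h1 h2
      have ht0 : (0 : ℝ) < t := by exact_mod_cast h1
      set c := ∫ z, clip (threshold p σs σl δ G t) (g (x t ω) z) ∂𝒟 with hc
      have e : clip (threshold p σs σl δ G t) (g (x t ω) (ξ t ω)) =
          c + noise 𝒟 g (threshold p σs σl δ G t) (x t ω) (ξ t ω) := by
        rw [noise, ← hc]; abel
      rw [e] at hstep
      have hd := hstep.descent hX hμ hr (hη t h1) (eta_le hμ h1) hf hG hxs hy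
      have hbias : ‖c - gradf (x t ω)‖ ≤ biasBound p σs σl δ G t :=
        (hM _ hy).norm_integral_clip_sub_le h.one_lt h.le_two h.small_nonneg h.large_nonneg
          ⟨h.large_eq_zero, fun h0 => le_antisymm (h0 ▸ h.small_le_large) h.small_nonneg⟩
          (hG _ hy) (le_max_left _ _)
      have hbias2 : 16 / μ * ‖c - gradf (x t ω)‖ ^ 2 ≤
          16 / μ * biasBound p σs σl δ G t ^ 2 := by gcongr
      have e2 : 1 / (2 * (6 / (μ * (t : ℝ)))) = μ * t / 12 := by field_simp; ring
      rw [e2] at hd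
      linarith
    -- The budget is 10 + 64080 + 20160 ≤ 10⁶/2.
    · simp only [(hrun ω).1]
      rw [norm_sub_rev, hB]
      have : 0 ≤ μ * ‖xs - x₁‖ ^ 2 := by positivity
      linarith
  have hexp : Real.exp (-Real.log (3 / δ)) = δ / 3 := by
    have := h.delta_pos
    rw [Real.exp_neg, Real.exp_log (by positivity), inv_div]
  rw [hexp] at hlin hquad
  have hδ := h.delta_pos
  have hone : 1 ≤ P A + ENNReal.ofReal δ := by
    calc 1 = P Set.univ := measure_univ.symm
      _ ≤ P (A ∪ (A₁ ∪ A₂)) := measure_mono hcover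
      _ ≤ P A + (P A₁ + P A₂) :=
          (measure_union_le _ _).trans (add_le_add_right (measure_union_le _ _) _)
      -- Only two of the three shares δ/3 are spent.
      _ ≤ P A + (ENNReal.ofReal (δ / 3) + ENNReal.ofReal (δ / 3)) := by gcongr
      _ ≤ P A + ENNReal.ofReal δ := by
          rw [← ENNReal.ofReal_add (by positivity) (by positivity)]
          gcongr
          linarith
  rw [ENNReal.ofReal_sub _ hδ.le, ENNReal.ofReal_one]
  exact tsub_le_iff_right.2 hone

/-- Jensen's inequality, with the total weight bounded below by T³/3. -/
lemma weightedAverage_gap_le {F : EuclideanSpace ℝ (Fin d) → ℝ} (hF : ConvexOn ℝ Set.univ F)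
    (hT : 1 ≤ T) (y : ℕ → EuclideanSpace ℝ (Fin d)) {Fs : ℝ} (hB0 : 0 ≤ B)
    (h : ∑ t ∈ Finset.Icc 1 T, weight t * (F (y (t + 1)) - Fs) ≤ B) :
    F (weightedAverage T y) - Fs ≤ 3 * B / (T : ℝ) ^ 3 := by
  have hT0 : (0 : ℝ) < T := by exact_mod_cast hT
  have hcube := cube_le_sum_weight T
  have e : weightedAverage T y = (∑ t ∈ Finset.Icc 1 T, weight t)⁻¹ •
      ∑ t ∈ Finset.Icc 1 T, weight t • y (t + 1) := rfl
  set Z := ∑ t ∈ Finset.Icc 1 T, weight t with hZ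
  have hZ0 : 0 < Z := lt_of_lt_of_le (by positivity) hcube
  have hJ : F (weightedAverage T y) ≤ ∑ t ∈ Finset.Icc 1 T, (Z⁻¹ * weight t) * F (y (t + 1)) := by
    rw [e, Finset.smul_sum]
    simp_rw [smul_smul]
    refine hF.map_sum_le (fun t _ => mul_nonneg (inv_nonneg.2 hZ0.le) (weight_pos t).le) ?_
      fun _ _ => Set.mem_univ _
    rw [← Finset.mul_sum, ← hZ, inv_mul_cancel₀ hZ0.ne']
  simp_rw [mul_sub, mul_assoc] at h hJ
  rw [← Finset.mul_sum] at hJ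
  rw [Finset.sum_sub_distrib, ← Finset.sum_mul, ← hZ] at h
  have h1 : Z⁻¹ * ∑ t ∈ Finset.Icc 1 T, weight t * F (y (t + 1)) ≤ Z⁻¹ * (B + Z * Fs) := by
    gcongr
    linarith
  have h2 : Z⁻¹ * (B + Z * Fs) = B / Z + Fs := by field_simp
  have h3 : B / Z ≤ B / ((T : ℝ) ^ 3 / 3) := by gcongr
  have h4 : B / ((T : ℝ) ^ 3 / 3) = 3 * B / (T : ℝ) ^ 3 := by field_simp
  linarith

end Main

end ClippedSGD

theorem mainTheorem2 :
    ∃ C : ℝ, 0 < C ∧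
      ∀ (d : ℕ) (X : Set (EuclideanSpace ℝ (Fin d))) (f r : EuclideanSpace ℝ (Fin d) → ℝ)
        (gradf : EuclideanSpace ℝ (Fin d) → EuclideanSpace ℝ (Fin d))
        (xstar x₁ : EuclideanSpace ℝ (Fin d)) (μ G p σs σl δ : ℝ)
        (Ξ : Type*) [MeasurableSpace Ξ] (𝒟 : Measure Ξ) [IsProbabilityMeasure 𝒟]
        (g : EuclideanSpace ℝ (Fin d) → Ξ → EuclideanSpace ℝ (Fin d))
        (Ω : Type*) [MeasurableSpace Ω] (P : Measure Ω) [IsProbabilityMeasure P]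
        (ξ : ℕ → Ω → Ξ) (x : ℕ → Ω → EuclideanSpace ℝ (Fin d)) (T : ℕ),
      -- the problem: `X` closed and convex, with a minimizer `xstar` of `F = f + r` on `X`
      IsClosed X → Convex ℝ X →
      xstar ∈ X → IsMinOn (fun y => f y + r y) X xstar →
      ConvexOn ℝ Set.univ f → ConvexOn ℝ Set.univ r →
      0 < μ → ClippedSGD.StronglyConvexFirstOrder X μ r →
      -- subgradients of `f` on `X` bounded by `G`, estimated by the stochastic oracle
      0 ≤ G → (∀ y ∈ X, gradf y ∈ ClippedSGD.subdifferential f y) → (∀ y ∈ X, ‖gradf y‖ ≤ G) →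
      1 < p → p ≤ 2 → ClippedSGD.HeavyTailedOracle X gradf g 𝒟 p σs σl →
      0 < δ → δ ≤ 1 → 1 ≤ T →
      -- `T` independent samples of law `𝒟`, and the iterates of Clipped SGD
      (∀ t, 1 ≤ t → t ≤ T → Measurable (ξ t) ∧ P.map (ξ t) = 𝒟) →
      iIndepFun (fun t : Set.Icc 1 T => ξ t) P →
      x₁ ∈ X →
      ClippedSGD.IsClippedSGDRun X r g (fun t => 6 / (μ * t))
        (fun t => max (2 * G) (ClippedSGD.tauStar p σs σl δ * (t : ℝ) ^ (1 / p))) x₁ ξ T x →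
      ClippedSGD.phi p σs σl δ G T ≤ ClippedSGD.phiStar p σs σl δ ∧
      (2 ^ p * (G ^ p / σl ^ p) * ClippedSGD.phiStar p σs σl δ ≤ T →
        ClippedSGD.phi p σs σl δ G T = ClippedSGD.phiStar p σs σl δ) ∧
      ENNReal.ofReal (1 - δ) ≤
        P {ω |
          (f (ClippedSGD.weightedAverage T fun t => x t ω) +
              r (ClippedSGD.weightedAverage T fun t => x t ω)) - (f xstar + r xstar)
            ≤ C * ClippedSGD.rate p σs σl δ G μ ‖xstar - x₁‖ T ∧
          μ * ‖x (T + 1) ω - xstar‖ ^ 2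
            ≤ C * ClippedSGD.rate p σs σl δ G μ ‖xstar - x₁‖ T} := by
  -- The last iterate requires 12B/T³; the average requires only 3B/T³.
  refine ⟨12 * 10 ^ 6, by norm_num, ?_⟩
  intro d X f r gradf xstar x₁ μ G p σs σl δ Ξ _ 𝒟 _ g Ω _ P _ ξ x T hXc hX hxs hmin hf hr hμ
    hsc hG0 hsub hG hp hp2 horacle hδ hδ1 hT hξ hind hx₁ hrun
  have hs := horacle.zero_le_small
  have hl := hs.trans horacle.small_le_large
  have h : ClippedSGD.Admissible p σs σl δ G :=
    { one_lt := hp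
      le_two := hp2
      small_nonneg := hs
      small_le_large := horacle.small_le_large
      -- All that is needed of σl ≤ √(πd/2) σs is that σl vanishes with σs.
      large_eq_zero := fun h0 => le_antisymm (by simpa [h0] using horacle.large_le) hl
      delta_pos := hδ
      delta_le_one := hδ1
      bound_nonneg := hG0 }
  refine ⟨ClippedSGD.phi_le_phiStar _ _ _ _ _ _, ClippedSGD.phi_eq_phiStar hl hG0 hδ hδ1, ?_⟩
  -- The oracle is measurable only on X × Ξ. The run stays in X, so it is also a run of the extended
  -- oracle.
  obtain ⟨g', hg', heq⟩ := ClippedSGD.exists_measurable_extension hXc horacle.measurable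
  have hrun' : ClippedSGD.IsClippedSGDRun X r g' (fun t => 6 / (μ * t))
      (ClippedSGD.threshold p σs σl δ G) x₁ ξ T x := fun ω =>
    ⟨(hrun ω).1, fun t h1 h2 => by
      rw [heq _ (hrun.mem hx₁ h1 (by omega) ω)]
      exact (hrun ω).2 t h1 h2⟩
  have hgood := h.measure_good_ge hμ hT hX hxs hmin hsc hsub hG hg'
    (fun y hy => by rw [heq y hy]; exact horacle.momentBounds hy) hξ hind hx₁ hrun' rfl
  refine hgood.trans (measure_mono fun ω hω => ?_)
  obtain ⟨hω1, hω2⟩ := hω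
  have hT0 : (0 : ℝ) < T := by exact_mod_cast hT
  have hQ0 : 0 ≤ T ^ 3 * ClippedSGD.rate p σs σl δ G μ ‖xstar - x₁‖ T :=
    le_trans (by positivity) (h.rate_parts (D := ‖xstar - x₁‖) hμ hT).1
  have hR0 : 0 ≤ ClippedSGD.rate p σs σl δ G μ ‖xstar - x₁‖ T :=
    nonneg_of_mul_nonneg_right hQ0 (by positivity)
  constructor
  · refine (ClippedSGD.weightedAverage_gap_le (F := fun y => f y + r y) (hf.add hr) hT
      (fun t => x t ω) (by positivity) hω1).trans ?_
    rw [div_le_iff₀ (by positivity)]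
    nlinarith
  · refine le_of_mul_le_mul_left ?_ (pow_pos hT0 3)
    linarith
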